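/- **Setting.** Let $T$ be a complete (possibly many-sorted) first-order theory and let $\mathfrak C$ be a monster model of $T$: a model that is $\kappa$-saturated and $\kappa$-strongly homogeneous, where $\kappa>|T|+\aleph_0$ is a strong limit cardinal ($|T|$ counts sorts and symbols of the language). *Small* (or *bounded*) means of cardinality less than $\kappa$. A subset of a small product of sorts of $\mathfrak C$ is *$A$-type-definable* if it is the intersection of a small number of sets definable with parameters from $A$, and *type-definable* if it is so over some small $A$. For tuples, $\equiv$ means having the same type over $\emptyset$; on each small product of sorts, $\equiv_L$ is the finest bounded $\operatorname{Aut}(\mathfrak C)$-invariant equivalence relation. $\operatorname{Autf}_L(\mathfrak C)$ is the normal subgroup of $\operatorname{Aut}(\mathfrak C)$ generated by the pointwise stabilisers of small elementary submodels, and $\operatorname{Gal}(T)=\operatorname{Aut}(\mathfrak C)/\operatorname{Autf}_L(\mathfrak C)$. If $m$ enumerates a small elementary submodel, then $\sigma\mapsto[\sigma(m)]_{\equiv_L}$ identifies $\operatorname{Gal}(T)$ with $[m]_{\equiv}/{\equiv_L}$; a subset of $\operatorname{Gal}(T)$ is *closed* if the corresponding subset of $[m]_\equiv/{\equiv_L}$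 has type-definable preimage in $[m]_\equiv$ (this does not depend on $m$). Let $X$ be a $\emptyset$-type-definable subset of a small product of sorts. For $\Gamma\le\operatorname{Aut}(\mathfrak C)$ and $\tilde X\subseteq X$ let $R_{\Gamma,\tilde X}$ be the relation on $X$ given by $$x_1\mathrel{R_{\Gamma,\tilde X}}x_2\iff \exists\sigma\in\operatorname{Aut}(\mathfrak C)\ \exists\gamma\in\Gamma\quad \sigma x_1=\gamma\sigma x_2\in\tilde X .$$ An equivalence relation $E$ on $X$ is *weakly orbital* if $E=R_{\Gamma,\tilde X}$ for some $\Gamma\le\operatorname{Aut}(\mathfrak C)$ and $\tilde X\subseteq X$, and *weakly orbital by type-definable* if this holds for some $\Gamma$ and some type-definable $\tilde X$. A group $\Gamma$ is a *maximal witness* if for some $\tilde X$ we have $E=R_{\Gamma,\tilde X}$, and $E\ne R_{\Gamma',\tilde X}$ for all $\Gamma'\gneq\Gamma$. A set $\tilde X$ is a *maximal witness* if for some $\Gamma$ we have $E=R_{\Gamma,\tilde X}$, and $E\neq R_{\Gamma,\tilde X'}$ for all $\tilde X\subsetneq\tilde X'\subseteq X$. For $E$ bounded (i.e. with a small number of classes)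 and invariant, the *logic topology* on $X/E$ is the one in which a set is closed iff its preimage in $X$ is type-definable. **Theorem.** Let $E$ be a bounded, $\operatorname{Aut}(\mathfrak C)$-invariant, weakly orbital equivalence relation on $X$. The following are equivalent: 1. $E$ is type-definable (as a subset of $X\times X$); 2. each $E$-class is type-definable and $E$ is weakly orbital by type-definable; 3. $E=R_{\Gamma,\tilde X}$ for some type-definable $\tilde X\subseteq X$ and some $\Gamma\le\operatorname{Aut}(\mathfrak C)$ which is the preimage of a closed subgroup of $\operatorname{Gal}(T)$; 4. every group $\Gamma\le\operatorname{Aut}(\mathfrak C)$ that is a maximal witness for weak orbitality of $E$ is the preimage of a closed subgroup of $\operatorname{Gal}(T)$, and every $\tilde X\subseteq X$ that is a maximal witness for weak orbitality of $E$ is type-definable; 5. $X/E$ with the logic topology is a Hausdorff space. -/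

import Mathlib

open Cardinal

universe u

/-! ### Abstract group actions: invariant and weakly orbital relations -/

section Abstract

variable (G : Type*) [Group G] {X : Type*} [MulAction G X]

/-- The equivalence relation `E` on the `G`-space `X` is `G`-invariant. -/
def IsInvariantRel (E : Setoid X) : Prop :=
  ∀ (g : G) (x y : X), E x y ↔ E (g • x) (g • y)

variable {G}

/-- The relation `R_{H, X̃}`: `x₁ R x₂` iff `g x₁ = h g x₂ ∈ X̃` for some `g ∈ G`, `h ∈ H`. -/
def orbRel (H : Subgroup G) (X' : Set X) (x₁ x₂ : X) : Prop :=
  ∃ g : G, ∃ h ∈ H, g • x₁ = h • g • x₂ ∧ g • x₁ ∈ X'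

/-- `E = R_{H, X̃}`. -/
def IsWitnessPair (E : Setoid X) (H : Subgroup G) (X' : Set X) : Prop :=
  ∀ x y : X, E x y ↔ orbRel H X' x y

variable (G) in
/-- `E` is weakly orbital: `E = R_{H, X̃}` for some `H ≤ G` and `X̃ ⊆ X`. -/
def IsWeaklyOrbital (E : Setoid X) : Prop :=
  ∃ (H : Subgroup G) (X' : Set X), IsWitnessPair E H X'

/-- The group `H` is a maximal witness for weak orbitality of `E`. -/
def IsMaxGroupWitness (E : Setoid X) (H : Subgroup G) : Prop :=
  ∃ X' : Set X, IsWitnessPair E H X' ∧ ∀ H' : Subgroup G, H < H' → ¬ IsWitnessPair E H' X'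

variable (G) in
/-- The set `X̃` is a maximal witness for weak orbitality of `E`. -/
def IsMaxSetWitness (E : Setoid X) (X' : Set X) : Prop :=
  ∃ H : Subgroup G, IsWitnessPair E H X' ∧ ∀ X'' : Set X, X' ⊂ X'' → ¬ IsWitnessPair E H X''

end Abstract

/-! ### Many-sorted first-order logic -/

/-- A many-sorted first-order language: sorts, function symbols (constants are the function symbols
of arity `0`) and relation symbols. -/
structure MSLanguage where
  Srt : Type u
  Fn : Type u
  fnArity : Fn → ℕ
  fnDom : ∀ f : Fn, Fin (fnArity f) → Srt
  fnCod : Fn → Srt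
  Rel : Type u
  relArity : Rel → ℕ
  relDom : ∀ r : Rel, Fin (relArity r) → Srt

namespace MSLanguage

/-- The number of sorts and symbols of the language. -/
def card (L : MSLanguage.{u}) : Cardinal.{u} := #L.Srt + #L.Fn + #L.Rel

/-- The product of sorts `∏ i, M (σ i)`. -/
def Tuple {S : Type u} (M : S → Type u) {I : Type*} (σ : I → S) : Type _ := ∀ i, M (σ i)

/-- Concatenation of tuples: `∏ i, M (σ i) × ∏ j, M (τ j) → ∏ k : I ⊕ J, M ((σ, τ) k)`. -/
def Tuple.append {S : Type u} {M : S → Type u} {I J : Type*} {σ : I → S} {τ : J → S}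
    (x : Tuple M σ) (y : Tuple M τ) : Tuple M (Sum.elim σ τ) :=
  fun k => match k with
    | .inl i => x i
    | .inr j => y j

/-- Adding a first entry `a` to the tuple `xs`. -/
def Tuple.cons {S : Type u} {M : S → Type u} {s : S} {b : List S} (a : M s)
    (xs : Tuple M b.get) : Tuple M (s :: b).get :=
  fun k => match k with
    | ⟨0, _⟩ => a
    | ⟨i + 1, h⟩ => xs ⟨i, Nat.lt_of_succ_lt_succ h⟩

/-- An `L`-structure with universes `M s`, `s` ranging over the sorts of `L`. -/
class Structure (L : MSLanguage.{u}) (M : L.Srt → Type u) where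
  funMap : ∀ f : L.Fn, Tuple M (L.fnDom f) → M (L.fnCod f)
  relMap : ∀ r : L.Rel, Tuple M (L.relDom r) → Prop

/-- Terms (indexed by their sort) in variables `v : V`, where `v` has sort `σ v`. -/
inductive Term (L : MSLanguage.{u}) {V : Type u} (σ : V → L.Srt) : L.Srt → Type u
  | var (v : V) : Term L σ (σ v)
  | app (f : L.Fn) (ts : ∀ i, Term L σ (L.fnDom f i)) : Term L σ (L.fnCod f)

/-- Formulas in free variables `v : V` of sorts `σ v` and in finitely many further variables (those
quantified so far), whose sorts are listed in the index. -/
inductive BFormula (L : MSLanguage.{u}) {V : Type u} (σ : V → L.Srt) : List L.Srt → Type u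
  | falsum {b : List L.Srt} : BFormula L σ b
  | equal {b : List L.Srt} {s : L.Srt} (t₁ t₂ : Term L (Sum.elim σ b.get) s) : BFormula L σ b
  | rel {b : List L.Srt} (r : L.Rel) (ts : ∀ i, Term L (Sum.elim σ b.get) (L.relDom r i)) :
      BFormula L σ b
  | imp {b : List L.Srt} (φ ψ : BFormula L σ b) : BFormula L σ b
  | all {b : List L.Srt} (s : L.Srt) (φ : BFormula L σ (s :: b)) : BFormula L σ b

/-- First-order formulas in free variables `v : V` of sorts `σ v`. -/
abbrev Formula (L : MSLanguage.{u}) {V : Type u} (σ : V → L.Srt) : Type u := BFormula L σ []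

section Semantics

variable {L : MSLanguage.{u}} {M : L.Srt → Type u} [L.Structure M]

/-- The value of a term. -/
def Term.realize {V : Type u} {σ : V → L.Srt} (v : Tuple M σ) : {s : L.Srt} → Term L σ s → M s
  | _, .var x => v x
  | _, .app f ts => Structure.funMap f (fun i => (ts i).realize v)

/-- Satisfaction (Tarski's definition of truth). -/
def BFormula.Realize {V : Type u} {σ : V → L.Srt} (v : Tuple M σ) :
    {b : List L.Srt} → BFormula L σ b → Tuple M b.get → Prop
  | _, .falsum, _ => False
  | _, .equal t₁ t₂, xs => t₁.realize (v.append xs) = t₂.realize (v.append xs)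
  | _, .rel r ts, xs => Structure.relMap r (fun i => (ts i).realize (v.append xs))
  | _, .imp φ ψ, xs => φ.Realize v xs → ψ.Realize v xs
  | _, .all s φ, xs => ∀ a : M s, φ.Realize v (Tuple.cons a xs)

/-- The tuple `v` satisfies the formula `φ`. -/
def Formula.Holds {V : Type u} {σ : V → L.Srt} (φ : Formula L σ) (v : Tuple M σ) : Prop :=
  BFormula.Realize v φ (fun i : Fin 0 => i.elim0)

variable (L M)

/-- The group of automorphisms of the structure `M`. -/
def Aut : Subgroup (∀ s, Equiv.Perm (M s)) where
  carrier := {g | (∀ (f : L.Fn) (x : Tuple M (L.fnDom f)),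
      g _ (Structure.funMap f x) = Structure.funMap f (fun i => g _ (x i))) ∧
    ∀ (r : L.Rel) (x : Tuple M (L.relDom r)),
      Structure.relMap r (fun i => g _ (x i)) ↔ Structure.relMap r x}
  mul_mem' := by
    rintro g h ⟨hg, hg'⟩ ⟨hh, hh'⟩
    refine ⟨fun f x => ?_, fun r x => ?_⟩
    · simp only [Pi.mul_apply, Equiv.Perm.mul_apply, hh]
      exact hg f fun i => h _ (x i)
    · simpa using (hg' r (fun i => h _ (x i))).trans (hh' r x)
  one_mem' := ⟨fun _ _ => rfl, fun _ _ => Iff.rfl⟩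
  inv_mem' := by
    rintro g ⟨hg, hg'⟩
    refine ⟨fun f x => ?_, fun r x => ?_⟩
    · refine (Equiv.symm_apply_eq (g (L.fnCod f))).2 ((congrArg _ ?_).trans (hg f _).symm)
      funext i
      exact ((g _).apply_symm_apply (x i)).symm
    · simpa using (hg' r (fun i => (g _)⁻¹ (x i))).symm

variable {L M}

/-- The coordinatewise action of the automorphism group on a product of sorts. -/
instance {I : Type*} {σ : I → L.Srt} : MulAction (Aut L M) (Tuple M σ) where
  smul g x := fun i => g.1 (σ i) (x i)
  one_smul _ := rfl
  mul_smul _ _ _ := rfl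

theorem smul_apply {I : Type*} {σ : I → L.Srt} (g : Aut L M) (x : Tuple M σ) (i : I) :
    (g • x) i = g.1 (σ i) (x i) := rfl

theorem Term.realize_smul {V : Type u} {σ : V → L.Srt} (g : Aut L M) (v : Tuple M σ) {s : L.Srt}
    (t : Term L σ s) : t.realize (g • v) = g.1 s (t.realize v) := by
  induction t with
  | var x => rfl
  | app f ts ih =>
    simp only [Term.realize, ih]
    exact (g.2.1 f _).symm

theorem append_smul {I J : Type*} {σ : I → L.Srt} {τ : J → L.Srt} (g : Aut L M)
    (x : Tuple M σ) (y : Tuple M τ) : (g • x).append (g • y) = g • x.append y := by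
  funext k
  cases k <;> rfl

theorem BFormula.realize_smul {V : Type u} {σ : V → L.Srt} (g : Aut L M) (v : Tuple M σ)
    {b : List L.Srt} (φ : BFormula L σ b) (xs : Tuple M b.get) :
    φ.Realize (g • v) (g • xs) ↔ φ.Realize v xs := by
  induction φ with
  | falsum => rfl
  | equal t₁ t₂ =>
    simp only [BFormula.Realize, append_smul, Term.realize_smul, EmbeddingLike.apply_eq_iff_eq]
  | rel r ts =>
    simp only [BFormula.Realize, append_smul, Term.realize_smul]
    exact g.2.2 r _
  | imp φ ψ ih₁ ih₂ => simp only [BFormula.Realize, ih₁, ih₂]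
  | @all b s φ ih =>
    simp only [BFormula.Realize]
    refine (Equiv.forall_congr (g.1 s) fun a => ?_).symm
    rw [← ih]
    refine iff_of_eq (congrArg _ ?_)
    funext i
    rcases i with ⟨_ | i, hi⟩ <;> rfl

theorem Formula.holds_smul {V : Type u} {σ : V → L.Srt} (g : Aut L M) (v : Tuple M σ)
    (φ : Formula L σ) : φ.Holds (g • v) ↔ φ.Holds v := by
  refine Iff.trans (iff_of_eq (congrArg (BFormula.Realize (g • v) φ) ?_))
    (BFormula.realize_smul g v φ fun i : Fin 0 => i.elim0)
  funext i
  exact i.elim0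

/-- Two tuples have the same type over `∅`. -/
def SameType {I : Type u} {σ : I → L.Srt} (x y : Tuple M σ) : Prop :=
  ∀ φ : Formula L σ, φ.Holds x ↔ φ.Holds y

/-- The set `D` is definable by a formula with parameters from `A`. -/
def DefinableOver (A : Set (Σ s, M s)) {I : Type u} {σ : I → L.Srt} (D : Set (Tuple M σ)) : Prop :=
  ∃ φ : Formula L (Sum.elim σ fun a : A => a.1.1),
    ∀ x, x ∈ D ↔ φ.Holds (x.append (τ := fun a : A => a.1.1) fun a => a.1.2)

/-- `Y` is type-definable over `A`: an intersection of fewer than `κ` sets definable over `A`. -/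
def TypeDefinableOver (κ : Cardinal.{u}) (A : Set (Σ s, M s)) {I : Type u} {σ : I → L.Srt}
    (Y : Set (Tuple M σ)) : Prop :=
  ∃ F : Set (Set (Tuple M σ)), #F < κ ∧ (∀ D ∈ F, DefinableOver A D) ∧ Y = ⋂₀ F

/-- `Y` is type-definable, over some small set of parameters. -/
def TypeDefinable (κ : Cardinal.{u}) {I : Type u} {σ : I → L.Srt} (Y : Set (Tuple M σ)) : Prop :=
  ∃ A : Set (Σ s, M s), #A < κ ∧ TypeDefinableOver κ A Y

variable (L M) in
/-- `M` is a monster model with respect to the strong limit cardinal `κ` (of its complete theory):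
`κ` exceeds `ℵ₀` and the size of the language, and `M` is `κ`-saturated and `κ`-strongly
homogeneous. -/
structure IsMonster (κ : Cardinal.{u}) : Prop where
  strongLimit : κ.IsStrongLimit
  aleph0_lt : ℵ₀ < κ
  card_lt : L.card < κ
  /-- A family of subsets of a sort, definable over a small set, with the finite intersection
  property has nonempty intersection. -/
  saturated : ∀ (A : Set (Σ s, M s)), #A < κ → ∀ (s : L.Srt)
    (F : Set (Set (Tuple M fun _ : PUnit.{u + 1} => s))), (∀ D ∈ F, DefinableOver A D) →
    (∀ t ⊆ F, t.Finite → (⋂₀ t).Nonempty) → (⋂₀ F).Nonempty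
  /-- Two small tuples of the same type are conjugate by an automorphism. -/
  homogeneous : ∀ (J : Type u) (σ : J → L.Srt), #J < κ → ∀ x y : Tuple M σ, SameType x y →
    ∃ g : Aut L M, g • x = y

/-- The family of maps `j s : N s → M s` is an elementary embedding. -/
def IsElementary {N : L.Srt → Type u} [L.Structure N] (j : ∀ s, N s → M s) : Prop :=
  ∀ (V : Type u) (σ : V → L.Srt) (φ : Formula L σ) (v : Tuple N σ),
    φ.Holds (fun i => j (σ i) (v i) : Tuple M σ) ↔ φ.Holds v

/-- The tuple of elements of `M` that enumerates the image of `j`. -/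
def enumTuple {N : L.Srt → Type u} (j : ∀ s, N s → M s) :
    Tuple M (Sigma.fst : (Σ s, N s) → L.Srt) := fun a => j a.1 a.2

/-- `x ≡_L y`: equivalence with respect to the finest bounded invariant equivalence relation on the
product of sorts. -/
def LascarEquiv (κ : Cardinal.{u}) {I : Type u} {σ : I → L.Srt} (x y : Tuple M σ) : Prop :=
  ∀ E : Setoid (Tuple M σ), IsInvariantRel (Aut L M) E → #(Quotient E) < κ → E x y

variable (L M)

/-- The group of Lascar strong automorphisms, generated by the pointwise stabilisers of (images of
elementary embeddings of small models, i.e.) small elementary submodels. -/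
def AutfL (κ : Cardinal.{u}) : Subgroup (Aut L M) :=
  Subgroup.closure {g | ∃ (N : L.Srt → Type u) (_ : L.Structure N) (j : ∀ s, N s → M s),
    IsElementary j ∧ #(Σ s, N s) < κ ∧ g • enumTuple j = enumTuple j}

instance (κ : Cardinal.{u}) : (AutfL L M κ).Normal := by
  refine ⟨fun n hn g => ?_⟩
  refine Subgroup.closure_induction
    (p := fun n _ => g * n * g⁻¹ ∈ AutfL L M κ) ?_ ?_ ?_ ?_ hn
  · rintro f ⟨N, iN, j, hj, hN, hf⟩
    refine Subgroup.subset_closure ⟨N, iN, fun s a => g.1 s (j s a), ?_, hN, ?_⟩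
    · intro V σ φ v
      exact (Formula.holds_smul g (fun i => j (σ i) (v i) : Tuple M σ) φ).trans (hj V σ φ v)
    · have h : enumTuple (fun s a => g.1 s (j s a)) = g • enumTuple j := rfl
      rw [h, smul_smul, inv_mul_cancel_right, mul_smul, hf]
  · simp
  · intro x y _ _ hx hy
    have := (AutfL L M κ).mul_mem hx hy
    simpa only [mul_assoc, inv_mul_cancel_left] using this
  · intro x _ hx
    have := (AutfL L M κ).inv_mem hx
    simpa [mul_assoc] using this

/-- The Galois group `Gal(T) = Aut(M) / Autf_L(M)`. -/
abbrev Gal (κ : Cardinal.{u}) : Type u := Aut L M ⧸ AutfL L M κ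

variable {L M}

/-- Closedness in the logic topology on `Gal(T)`. For a tuple `m` enumerating a small elementary
submodel, `Gal(T)` is identified with `[m]_≡ / ≡_L` through `g ↦ [g m]`, and a subset of
`[m]_≡ / ≡_L` is closed iff its preimage in `[m]_≡` is type-definable (the choice of `m` is
irrelevant). -/
def GalClosed {κ : Cardinal.{u}} (C : Set (Gal L M κ)) : Prop :=
  ∃ (N : L.Srt → Type u) (_ : L.Structure N) (j : ∀ s, N s → M s),
    IsElementary j ∧ #(Σ s, N s) < κ ∧
    TypeDefinable κ {n : Tuple M (Sigma.fst : (Σ s, N s) → L.Srt) | SameType (enumTuple j) n ∧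
      ∃ g : Aut L M, (QuotientGroup.mk g : Gal L M κ) ∈ C ∧ LascarEquiv κ n (g • enumTuple j)}

/-- `Γ` is the preimage in `Aut(M)` of a closed subgroup of `Gal(T)`. -/
def IsPreimageOfClosed (κ : Cardinal.{u}) (Γ : Subgroup (Aut L M)) : Prop :=
  ∃ K : Subgroup (Gal L M κ), GalClosed (K : Set (Gal L M κ)) ∧
    Γ = K.comap (QuotientGroup.mk' (AutfL L M κ))

theorem DefinableOver.smul_mem {I : Type u} {σ : I → L.Srt} {D : Set (Tuple M σ)}
    (hD : DefinableOver ∅ D) (g : Aut L M) {x : Tuple M σ} (hx : x ∈ D) : g • x ∈ D := by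
  obtain ⟨φ, hφ⟩ := hD
  rw [hφ] at hx ⊢
  rw [← Formula.holds_smul g] at hx
  convert hx using 2
  funext k
  rcases k with i | a
  · rfl
  · exact a.2.elim

theorem TypeDefinableOver.smul_mem {κ : Cardinal.{u}} {I : Type u} {σ : I → L.Srt}
    {Y : Set (Tuple M σ)} (hY : TypeDefinableOver κ ∅ Y) (g : Aut L M) {x : Tuple M σ}
    (hx : x ∈ Y) : g • x ∈ Y := by
  obtain ⟨F, -, hF, rfl⟩ := hY
  exact fun D hD => (hF D hD).smul_mem g (hx D hD)

variable (L M) in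
/-- A `∅`-type-definable subset of the product of sorts `∏ i, M (σ i)`. -/
structure ZeroTypeDefinable (κ : Cardinal.{u}) {I : Type u} (σ : I → L.Srt) where
  carrier : Set (Tuple M σ)
  typeDefinable : TypeDefinableOver κ ∅ carrier

variable {κ : Cardinal.{u}} {I : Type u} {σ : I → L.Srt}

instance : CoeSort (ZeroTypeDefinable L M κ σ) (Type u) := ⟨fun X => X.carrier⟩

/-- The action of the automorphism group on a `∅`-type-definable set. -/
instance (X : ZeroTypeDefinable L M κ σ) : MulAction (Aut L M) X where
  smul g x := ⟨g • x.1, X.typeDefinable.smul_mem g x.2⟩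
  one_smul _ := rfl
  mul_smul _ _ _ := rfl

/-- A subset of `X` is type-definable. -/
def TypeDefinableIn {X : ZeroTypeDefinable L M κ σ} (Y : Set X) : Prop :=
  TypeDefinable κ (Subtype.val '' Y)

/-- The relation `E` on `X` is type-definable (as a subset of `X × X`). -/
def TypeDefinableRel {X : ZeroTypeDefinable L M κ σ} (E : Setoid X) : Prop :=
  TypeDefinable κ {z : Tuple M (Sum.elim σ σ) | ∃ x y : X, E x y ∧ z = x.1.append y.1}

/-- `t` is the logic topology on `X / E`: the closed sets are precisely those with type-definable
preimage in `X`. -/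
def IsLogicTopology {X : ZeroTypeDefinable L M κ σ} (E : Setoid X)
    (t : TopologicalSpace (Quotient E)) : Prop :=
  ∀ C : Set (Quotient E), @IsClosed _ t C ↔ TypeDefinableIn ((Quotient.mk E) ⁻¹' C)

end Semantics

end MSLanguage

/-! The proof combines compactness with one fact: every class of a bounded invariant equivalence
relation is preserved by all Lascar strong automorphisms (`TarskiVaught.rel_smul`,
`IsMonster.rel_smul`). Consequently a type-definable union of `E`-classes is type-definable over any
one small elementary submodel (`closedOver_image_of_saturated`). With the parameters fixed once and
for all, intersections of such sets stay type-definable however many sets are involved.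

New sets are shown to be type-definable by writing them as projections: saturation makes projections
of type-definable sets type-definable (`ClosedOver.image`), and homogeneity turns an equality of
types into an automorphism. If `e` enumerates a small elementary submodel, then `g • e` determines
`g` up to `AutfL`. So for `Γ` containing `AutfL`, membership of `g` in `Γ` is a condition on `g •
e`, and it is type-definable exactly when `Γ` is the preimage of a closed subgroup.

Weak orbitality enters through the Galois connection between groups `H` and sets `X'` given by
"every `h ∈ H` fixes the class of every `x ∈ X'`". A witness pair may be enlarged on either side as
long as this condition holds (`IsWitnessPair.of_le`), so maximal groups are stabilisers of families
of classes and maximal sets are sets of points with fixed class. The former are preimages of closed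
subgroups once classes are type-definable (`isPreimageOfClosed_classStabilizer`); the latter are
type-definable once `E` is. Conversely, closed `Γ` and type-definable `X'` exhibit `R_{Γ, X'}` as a
projection (`IsPreimageOfClosed.typeDefinableRel`).

The Hausdorff condition is matched with type-definability by separating disjoint type-definable
classes by a definable set, and by reading open separations as closed sets containing the graph of
`E`. -/

namespace MSLanguage

/-! ### Substitution and finite support of formulas -/

section Substitution

variable {L : MSLanguage.{u}}

/-- Simultaneous substitution of terms for the variables of a term. -/
def Term.subst {V W : Type u} {σ : V → L.Srt} {τ : W → L.Srt} (f : ∀ v, Term L τ (σ v)) :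
    {s : L.Srt} → Term L σ s → Term L τ s
  | _, .var v => f v
  | _, .app g ts => .app g fun i => (ts i).subst f

/-- Regard a term as a term in a context with one more bound variable. -/
def Term.weaken {W : Type u} {τ : W → L.Srt} {b : List L.Srt} (s : L.Srt) {s' : L.Srt}
    (t : Term L (Sum.elim τ b.get) s') : Term L (Sum.elim τ (s :: b).get) s' :=
  t.subst fun k => match k with
    | .inl w => .var (σ := Sum.elim τ (s :: b).get) (.inl w)
    | .inr ⟨i, h⟩ => .var (σ := Sum.elim τ (s :: b).get) (.inr ⟨i + 1, Nat.succ_lt_succ h⟩)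

/-- Extend a substitution to one more bound variable, which is left unchanged. -/
def liftSubst {V W : Type u} {σ : V → L.Srt} {τ : W → L.Srt} {b b' : List L.Srt} (s : L.Srt)
    (f : ∀ k, Term L (Sum.elim τ b'.get) (Sum.elim σ b.get k)) :
    ∀ k, Term L (Sum.elim τ (s :: b').get) (Sum.elim σ (s :: b).get k) :=
  fun k => match k with
    | .inl v => (f (.inl v)).weaken s
    | .inr ⟨0, _⟩ => .var (σ := Sum.elim τ (s :: b').get) (.inr ⟨0, Nat.succ_pos _⟩)
    | .inr ⟨i + 1, h⟩ => (f (.inr ⟨i, Nat.lt_of_succ_lt_succ h⟩)).weaken s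

/-- Simultaneous substitution of terms for the free variables of a formula. -/
def BFormula.subst {V W : Type u} {σ : V → L.Srt} {τ : W → L.Srt} :
    {b b' : List L.Srt} → (∀ k, Term L (Sum.elim τ b'.get) (Sum.elim σ b.get k)) →
      BFormula L σ b → BFormula L τ b'
  | _, _, _, .falsum => .falsum
  | _, _, f, .equal t₁ t₂ => .equal (t₁.subst f) (t₂.subst f)
  | _, _, f, .rel r ts => .rel r fun i => (ts i).subst f
  | _, _, f, .imp φ ψ => .imp (φ.subst f) (ψ.subst f)
  | _, _, f, .all s φ => .all s (φ.subst (liftSubst s f))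

variable {M : L.Srt → Type u} [L.Structure M]

theorem Term.realize_subst {V W : Type u} {σ : V → L.Srt} {τ : W → L.Srt}
    (f : ∀ v, Term L τ (σ v)) (x : Tuple M τ) (y : Tuple M σ) (h : ∀ v, (f v).realize x = y v)
    {s : L.Srt} (t : Term L σ s) : (t.subst f).realize x = t.realize y := by
  induction t with
  | var v => exact h v
  | app g ts ih => simp only [Term.subst, Term.realize, ih]

theorem Term.realize_weaken {W : Type u} {τ : W → L.Srt} {b : List L.Srt} {s s' : L.Srt}
    (t : Term L (Sum.elim τ b.get) s') (x : Tuple M τ) (xs : Tuple M b.get) (a : M s) :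
    (t.weaken s).realize (x.append (Tuple.cons a xs)) = t.realize (x.append xs) := by
  refine Term.realize_subst _ _ _ ?_ t
  rintro (w | ⟨i, h⟩) <;> rfl

theorem BFormula.realize_subst {V W : Type u} {σ : V → L.Srt} {τ : W → L.Srt}
    {b b' : List L.Srt} (f : ∀ k, Term L (Sum.elim τ b'.get) (Sum.elim σ b.get k))
    (x : Tuple M τ) (xs : Tuple M b'.get) (y : Tuple M σ) (ys : Tuple M b.get)
    (h : ∀ k, (f k).realize (x.append xs) = y.append ys k) (φ : BFormula L σ b) :
    (φ.subst f).Realize x xs ↔ φ.Realize y ys := by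
  induction φ generalizing b' with
  | falsum => rfl
  | equal t₁ t₂ => simp only [BFormula.subst, BFormula.Realize, Term.realize_subst f _ _ h]
  | rel r ts => simp only [BFormula.subst, BFormula.Realize, Term.realize_subst f _ _ h]
  | imp φ ψ ih₁ ih₂ => simp only [BFormula.subst, BFormula.Realize, ih₁ f _ _ h, ih₂ f _ _ h]
  | all s φ ih =>
    simp only [BFormula.subst, BFormula.Realize]
    refine forall_congr' fun a => ih _ _ _ ?_
    rintro (v | ⟨_ | i, hi⟩)
    · exact (Term.realize_weaken _ _ _ _).trans (h (.inl v))
    · rfl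
    · exact (Term.realize_weaken _ _ _ _).trans (h (.inr ⟨i, _⟩))

/-- The value of a term depends on finitely many of its variables. -/
theorem Term.exists_finite_support {V : Type u} {σ : V → L.Srt} {s : L.Srt} (t : Term L σ s) :
    ∃ T : Set V, T.Finite ∧
      ∀ x y : Tuple M σ, (∀ v ∈ T, x v = y v) → t.realize x = t.realize y := by
  induction t with
  | var v => exact ⟨{v}, Set.finite_singleton v, fun x y h => h v rfl⟩
  | app f ts ih =>
    choose T hT h using ih
    refine ⟨⋃ i, T i, Set.finite_iUnion hT, fun x y hxy => ?_⟩
    simp only [Term.realize]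
    exact congrArg _ (funext fun i => h i x y fun v hv => hxy v (Set.mem_iUnion.2 ⟨i, hv⟩))

theorem Term.exists_finite_support_append {V : Type u} {σ : V → L.Srt} {b : List L.Srt}
    {s : L.Srt} (t : Term L (Sum.elim σ b.get) s) :
    ∃ T : Set V, T.Finite ∧ ∀ (x y : Tuple M σ) (xs : Tuple M b.get), (∀ v ∈ T, x v = y v) →
      t.realize (x.append xs) = t.realize (y.append xs) := by
  obtain ⟨T, hT, h⟩ := t.exists_finite_support (M := M)
  refine ⟨Sum.inl ⁻¹' T, hT.preimage Sum.inl_injective.injOn, fun x y xs hxy => h _ _ ?_⟩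
  rintro (v | i) hv
  · exact hxy v hv
  · rfl

/-- The truth value of a formula depends on finitely many of its free variables. -/
theorem BFormula.exists_finite_support {V : Type u} {σ : V → L.Srt} {b : List L.Srt}
    (φ : BFormula L σ b) :
    ∃ T : Set V, T.Finite ∧ ∀ (x y : Tuple M σ) (xs : Tuple M b.get), (∀ v ∈ T, x v = y v) →
      (φ.Realize x xs ↔ φ.Realize y xs) := by
  induction φ with
  | falsum => exact ⟨∅, Set.finite_empty, fun _ _ _ _ => Iff.rfl⟩
  | equal t₁ t₂ =>
    obtain ⟨T₁, hT₁, h₁⟩ := t₁.exists_finite_support_append (M := M)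
    obtain ⟨T₂, hT₂, h₂⟩ := t₂.exists_finite_support_append (M := M)
    refine ⟨T₁ ∪ T₂, hT₁.union hT₂, fun x y xs h => ?_⟩
    simp only [BFormula.Realize, h₁ x y xs fun v hv => h v (.inl hv),
      h₂ x y xs fun v hv => h v (.inr hv)]
  | rel r ts =>
    choose T hT h using fun i => (ts i).exists_finite_support_append (M := M)
    refine ⟨⋃ i, T i, Set.finite_iUnion hT, fun x y xs hxy => ?_⟩
    simp only [BFormula.Realize]
    exact iff_of_eq (congrArg _ (funext fun i =>
      h i x y xs fun v hv => hxy v (Set.mem_iUnion.2 ⟨i, hv⟩)))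
  | imp φ ψ ih₁ ih₂ =>
    obtain ⟨T₁, hT₁, h₁⟩ := ih₁
    obtain ⟨T₂, hT₂, h₂⟩ := ih₂
    refine ⟨T₁ ∪ T₂, hT₁.union hT₂, fun x y xs h => ?_⟩
    simp only [BFormula.Realize, h₁ x y xs fun v hv => h v (.inl hv),
      h₂ x y xs fun v hv => h v (.inr hv)]
  | all s φ ih =>
    obtain ⟨T, hT, h⟩ := ih
    exact ⟨T, hT, fun x y xs hxy => forall_congr' fun a => h x y _ hxy⟩

end Substitution

/-! ### Counting formulas -/

section Counting

variable {L : MSLanguage.{u}}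

/-- The symbols used to write terms and formulas as labelled trees. -/
abbrev Symb (L : MSLanguage.{u}) (V : Type u) : Type u :=
  (V ⊕ ℕ) ⊕ L.Fn ⊕ L.Rel ⊕ L.Srt ⊕ Bool ⊕ Unit

/-- The number of immediate subtrees below a symbol. -/
def symbArity (V : Type u) : Symb L V → ℕ
  | .inl _ => 0
  | .inr (.inl f) => L.fnArity f
  | .inr (.inr (.inl r)) => L.relArity r
  | .inr (.inr (.inr (.inl _))) => 1
  | .inr (.inr (.inr (.inr (.inl _)))) => 2
  | .inr (.inr (.inr (.inr (.inr _)))) => 0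

/-- Labelled trees. -/
abbrev Code (L : MSLanguage.{u}) (V : Type u) : Type u :=
  WType fun a : Symb L V => Fin (symbArity V a)

/-- A term as a labelled tree. -/
def Term.code {V : Type u} {σ : V → L.Srt} {b : List L.Srt} :
    {s : L.Srt} → Term L (Sum.elim σ b.get) s → Code L V
  | _, .var (.inl v) => .mk (.inl (.inl v)) Fin.elim0
  | _, .var (.inr i) => .mk (.inl (.inr i)) Fin.elim0
  | _, .app f ts => .mk (.inr (.inl f)) fun i => (ts i).code

/-- A formula as a labelled tree. -/
def BFormula.code {V : Type u} {σ : V → L.Srt} : {b : List L.Srt} → BFormula L σ b → Code L V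
  | _, .falsum => .mk (.inr (.inr (.inr (.inr (.inr ()))))) Fin.elim0
  | _, .equal t₁ t₂ => .mk (.inr (.inr (.inr (.inr (.inl true))))) ![t₁.code, t₂.code]
  | _, .rel r ts => .mk (.inr (.inr (.inl r))) fun i => (ts i).code
  | _, .imp φ ψ => .mk (.inr (.inr (.inr (.inr (.inl false))))) ![φ.code, ψ.code]
  | _, .all s φ => .mk (.inr (.inr (.inr (.inl s)))) fun _ => φ.code

/-- The code of an equation does not record the sort of its two sides, so the sort has to be
recovered from the code of a term; hence the heterogeneous conclusion. -/
theorem Term.code_inj {V : Type u} {σ : V → L.Srt} {b : List L.Srt} {s s' : L.Srt}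
    (t : Term L (Sum.elim σ b.get) s) (t' : Term L (Sum.elim σ b.get) s') (h : t.code = t'.code) :
    s = s' ∧ HEq t t' := by
  induction t generalizing s' with
  | var v =>
    rcases t' with w | ⟨g, ts'⟩
    · rcases v with v | v <;> rcases w with w | w <;> simp only [Term.code] at h <;>
        injection h with h₁ h₂ <;> simp at h₁
      · subst h₁; exact ⟨rfl, HEq.rfl⟩
      · obtain rfl := Fin.ext h₁; exact ⟨rfl, HEq.rfl⟩
    · rcases v with v | v <;> simp only [Term.code] at h <;> injection h with h₁ h₂ <;> simp at h₁
  | app f ts ih =>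
    rcases t' with w | ⟨g, ts'⟩
    · rcases w with v | v <;> simp only [Term.code] at h <;> injection h with h₁ h₂ <;> simp at h₁
    · simp only [Term.code] at h
      injection h with h₁ h₂
      simp at h₁
      subst h₁
      obtain rfl : ts = ts' := funext fun i =>
        eq_of_heq (ih i (ts' i) (congrFun (eq_of_heq h₂) i)).2
      exact ⟨rfl, HEq.rfl⟩

theorem BFormula.code_injective {V : Type u} {σ : V → L.Srt} {b : List L.Srt} :
    Function.Injective (BFormula.code : BFormula L σ b → Code L V) := by
  intro φ ψ h
  induction φ with
  | falsum =>
    cases ψ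
    case falsum => rfl
    all_goals simp only [BFormula.code] at h; injection h with h₁ h₂; simp at h₁
  | equal t₁ t₂ =>
    cases ψ <;> simp only [BFormula.code] at h <;> injection h with h₁ h₂ <;> simp at h₁
    rename_i s' u₁ u₂
    obtain ⟨rfl, h₃⟩ := Term.code_inj t₁ u₁ (congrFun h₂ (0 : Fin 2))
    obtain ⟨-, h₄⟩ := Term.code_inj t₂ u₂ (congrFun h₂ (1 : Fin 2))
    rw [eq_of_heq h₃, eq_of_heq h₄]
  | rel r ts =>
    cases ψ <;> simp only [BFormula.code] at h <;> injection h with h₁ h₂ <;> simp at h₁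
    subst h₁
    refine congrArg _ (funext fun i => eq_of_heq (Term.code_inj _ _ (congrFun (eq_of_heq h₂) i)).2)
  | imp φ φ' ih₁ ih₂ =>
    cases ψ <;> simp only [BFormula.code] at h <;> injection h with h₁ h₂ <;> simp at h₁
    rw [ih₁ (congrFun h₂ (0 : Fin 2)), ih₂ (congrFun h₂ (1 : Fin 2))]
  | all s φ ih =>
    cases ψ <;> simp only [BFormula.code] at h <;> injection h with h₁ h₂ <;> simp at h₁
    subst h₁
    exact congrArg _ (ih (congrFun h₂ (0 : Fin 1)))

/-- Codes are finitely branching well-founded trees, so there are at most `max ℵ₀` (number of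
symbols) of them. -/
theorem mk_formula_lt {κ : Cardinal.{u}} (hκ : ℵ₀ < κ) (hL : L.card < κ) {V : Type u}
    (hV : #V < κ) (σ : V → L.Srt) (b : List L.Srt) : #(BFormula L σ b) < κ := by
  refine (mk_le_of_injective BFormula.code_injective).trans_lt ?_
  refine (WType.cardinalMk_le_max_aleph0_of_finite' ).trans_lt (max_lt ?_ hκ)
  have hS : #L.Srt < κ := lt_of_le_of_lt (le_self_add.trans le_self_add) hL
  have hF : #L.Fn < κ := lt_of_le_of_lt (le_add_self.trans le_self_add) hL
  have hR : #L.Rel < κ := lt_of_le_of_lt le_add_self hL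
  have h : ∀ α : Type, [Finite α] → lift.{u} #α < κ := fun α _ =>
    (lift_lt_aleph0.2 (lt_aleph0_of_finite α)).trans hκ
  have hN : lift.{u} #ℕ < κ := by simpa using hκ
  simp only [Symb, mk_sum, lift_id, lift_uzero, lift_add]
  exact add_lt_of_lt hκ.le (add_lt_of_lt hκ.le hV hN) (add_lt_of_lt hκ.le hF
    (add_lt_of_lt hκ.le hR (add_lt_of_lt hκ.le hS (add_lt_of_lt hκ.le (h _) (h _)))))

end Counting

/-! ### Definable sets with parameters -/

section Definable

open Classical in
/-- Replace the entry at `i` by `a`. -/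
noncomputable def Tuple.update {S : Type u} {M : S → Type u} {I : Type u} {σ : I → S}
    (x : Tuple M σ) (i : I) (a : M (σ i)) : Tuple M σ :=
  Function.update x i a

theorem Tuple.update_self {S : Type u} {M : S → Type u} {I : Type u} {σ : I → S}
    (x : Tuple M σ) (i : I) (a : M (σ i)) : x.update i a i = a := by
  classical exact Function.update_self i a x

theorem Tuple.update_of_ne {S : Type u} {M : S → Type u} {I : Type u} {σ : I → S}
    (x : Tuple M σ) {i j : I} (h : j ≠ i) (a : M (σ i)) :
    x.update i a j = x j := by
  classical exact Function.update_of_ne h a x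

variable {L : MSLanguage.{u}} {M : L.Srt → Type u} [L.Structure M]

/-- The tuple enumerating a set of parameters. -/
def params (A : Set (Σ s, M s)) : Tuple M (fun a : A => a.1.1) := fun a => a.1.2

/-- `g` fixes the set `A` pointwise. -/
def Fixes (g : Aut L M) (A : Set (Σ s, M s)) : Prop := ∀ a ∈ A, g.1 a.1 a.2 = a.2

variable {I J : Type u} {σ : I → L.Srt} {τ : J → L.Srt} {A B : Set (Σ s, M s)}

/-- A map between products of sorts each of whose coordinates is given by a term over `A`. -/
def IsSubst (A : Set (Σ s, M s)) (F : Tuple M σ → Tuple M τ) : Prop :=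
  ∀ j, ∃ t : Term L (Sum.elim σ fun a : A => a.1.1) (τ j),
    ∀ x, F x j = t.realize (x.append (params A))

theorem exists_term_var (A : Set (Σ s, M s)) (i : I) :
    ∃ t : Term L (Sum.elim σ fun a : A => a.1.1) (σ i),
      ∀ x : Tuple M σ, x i = t.realize (x.append (params A)) :=
  ⟨.var (σ := Sum.elim σ _) (.inl i), fun _ => rfl⟩

theorem exists_term_const {s : L.Srt} {c : M s} (hc : ⟨s, c⟩ ∈ A) :
    ∃ t : Term L (Sum.elim σ fun a : A => a.1.1) s,
      ∀ x : Tuple M σ, c = t.realize (x.append (params A)) :=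
  ⟨.var (σ := Sum.elim σ fun a : A => a.1.1) (.inr ⟨_, hc⟩), fun _ => rfl⟩

theorem isSubst_id : IsSubst A (id : Tuple M σ → Tuple M σ) := exists_term_var A

theorem Fixes.mono {g : Aut L M} (h : Fixes g B) (hAB : A ⊆ B) : Fixes g A :=
  fun a ha => h a (hAB ha)

theorem Fixes.append_params {g : Aut L M} (h : Fixes g A) (x : Tuple M σ) :
    (g • x).append (params A) = g • x.append (params A) := by
  rw [← append_smul]
  refine congrArg _ (funext fun a => (h a.1 a.2).symm)

theorem IsSubst.smul {F : Tuple M σ → Tuple M τ} (hF : IsSubst A F) {g : Aut L M}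
    (hg : Fixes g A) (x : Tuple M σ) : F (g • x) = g • F x := by
  funext j
  obtain ⟨t, ht⟩ := hF j
  rw [ht, hg.append_params, Term.realize_smul, smul_apply, ht]

theorem IsSubst.mono {F : Tuple M σ → Tuple M τ} (hF : IsSubst A F) (hAB : A ⊆ B) :
    IsSubst B F := by
  intro j
  obtain ⟨t, ht⟩ := hF j
  refine ⟨t.subst fun v => match v with
    | .inl i => .var (σ := Sum.elim σ fun a : B => a.1.1) (.inl i)
    | .inr a => .var (σ := Sum.elim σ fun a : B => a.1.1) (.inr ⟨a.1, hAB a.2⟩), fun x => ?_⟩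
  rw [ht]
  refine (Term.realize_subst _ _ _ ?_ t).symm
  rintro (i | a) <;> rfl

theorem definableOver_iff {D : Set (Tuple M σ)} : DefinableOver A D ↔
    ∃ φ : Formula L (Sum.elim σ fun a : A => a.1.1), ∀ x, x ∈ D ↔ φ.Holds (x.append (params A)) :=
  Iff.rfl

theorem DefinableOver.smul_mem_iff {D : Set (Tuple M σ)} (hD : DefinableOver A D) {g : Aut L M}
    (hg : Fixes g A) {x : Tuple M σ} : g • x ∈ D ↔ x ∈ D := by
  obtain ⟨φ, hφ⟩ := definableOver_iff.1 hD
  rw [hφ, hφ, ← Formula.holds_smul g (x.append _)]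
  exact iff_of_eq (congrArg _ (hg.append_params x))

theorem DefinableOver.compl {D : Set (Tuple M σ)} (hD : DefinableOver A D) :
    DefinableOver A Dᶜ := by
  obtain ⟨φ, hφ⟩ := hD
  exact ⟨.imp φ .falsum, fun x => not_congr (hφ x)⟩

theorem definableOver_univ : DefinableOver A (Set.univ : Set (Tuple M σ)) :=
  ⟨.imp .falsum .falsum, fun _ => iff_of_true trivial id⟩

theorem definableOver_empty : DefinableOver A (∅ : Set (Tuple M σ)) :=
  ⟨.falsum, fun _ => Iff.rfl⟩

theorem DefinableOver.union {D D' : Set (Tuple M σ)} (hD : DefinableOver A D)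
    (hD' : DefinableOver A D') : DefinableOver A (D ∪ D') := by
  obtain ⟨φ, hφ⟩ := hD
  obtain ⟨ψ, hψ⟩ := hD'
  refine ⟨.imp (.imp φ .falsum) ψ, fun x => ?_⟩
  rw [Set.mem_union, hφ, hψ, or_iff_not_imp_left]
  rfl

theorem DefinableOver.inter {D D' : Set (Tuple M σ)} (hD : DefinableOver A D)
    (hD' : DefinableOver A D') : DefinableOver A (D ∩ D') := by
  simpa [Set.compl_union] using (hD.compl.union hD'.compl).compl

theorem DefinableOver.sInter {F : Set (Set (Tuple M σ))} (hF : F.Finite)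
    (h : ∀ D ∈ F, DefinableOver A D) : DefinableOver A (⋂₀ F) := by
  induction F, hF using Set.Finite.induction_on with
  | empty => simpa using definableOver_univ
  | insert _ _ ih =>
    rw [Set.sInter_insert]
    exact (h _ (Set.mem_insert _ _)).inter (ih fun D hD => h D (Set.mem_insert_of_mem _ hD))

theorem DefinableOver.preimage {D : Set (Tuple M τ)} (hD : DefinableOver A D)
    {F : Tuple M σ → Tuple M τ} (hF : IsSubst A F) : DefinableOver A (F ⁻¹' D) := by
  obtain ⟨φ, hφ⟩ := hD
  choose t ht using hF
  refine ⟨φ.subst (σ := Sum.elim τ fun a : A => a.1.1) (b' := [])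
    fun k : (J ⊕ A) ⊕ Fin ([] : List L.Srt).length => match k with
    | .inl (.inl j) => (t j).subst fun v =>
      .var (σ := Sum.elim (Sum.elim σ fun a : A => a.1.1) [].get) (.inl v)
    | .inl (.inr a) => .var (σ := Sum.elim (Sum.elim σ fun a : A => a.1.1) [].get) (.inl (.inr a))
    | .inr i => i.elim0, fun x => ?_⟩
  rw [Set.mem_preimage, hφ]
  refine (BFormula.realize_subst _ _ _ _ _ ?_ φ).symm
  rintro ((j | a) | i)
  · exact (Term.realize_subst _ _ (x.append (params A)) (fun v => rfl) (t j)).trans (ht j x).symm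
  · rfl
  · exact i.elim0

theorem DefinableOver.mono {D : Set (Tuple M σ)} (hD : DefinableOver A D) (hAB : A ⊆ B) :
    DefinableOver B D := by
  obtain ⟨φ, hφ⟩ := hD
  refine ⟨φ.subst (b' := []) fun k : (I ⊕ A) ⊕ Fin ([] : List L.Srt).length => match k with
    | .inl (.inl i) => .var (σ := Sum.elim (Sum.elim σ fun a : B => a.1.1) [].get) (.inl (.inl i))
    | .inl (.inr a) =>
      .var (σ := Sum.elim (Sum.elim σ fun a : B => a.1.1) [].get) (.inl (.inr ⟨a.1, hAB a.2⟩))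
    | .inr i => i.elim0, fun x => ?_⟩
  rw [hφ]
  refine (BFormula.realize_subst _ _ _ _ _ ?_ φ).symm
  rintro ((j | a) | i)
  · rfl
  · rfl
  · exact i.elim0

theorem Formula.definableOver_holds (φ : Formula L σ) (A : Set (Σ s, M s)) :
    DefinableOver A {x : Tuple M σ | φ.Holds x} := by
  refine ⟨φ.subst (b' := []) fun k => match k with
    | .inl i => .var (σ := Sum.elim (Sum.elim σ fun a : A => a.1.1) [].get) (.inl (.inl i))
    | .inr i => i.elim0, fun x => ?_⟩
  refine (BFormula.realize_subst _ _ _ _ _ ?_ φ).symm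
  rintro (j | i)
  · rfl
  · exact i.elim0

-- The variable `i` is turned into a bound variable and quantified by `¬∀¬`; all other variables are
-- left free.
open Classical in
theorem DefinableOver.exists_update {D : Set (Tuple M σ)} (hD : DefinableOver A D) (i : I) :
    DefinableOver A {x : Tuple M σ | ∃ a, x.update i a ∈ D} := by
  obtain ⟨φ, hφ⟩ := hD
  refine ⟨.imp (.all (σ i) (.imp (φ.subst (b' := [σ i])
    fun k : (I ⊕ A) ⊕ Fin ([] : List L.Srt).length => match k with
    | .inl (.inl j) => if h : i = j then
        h ▸ .var (σ := Sum.elim (Sum.elim σ fun a : A => a.1.1) [σ i].get) (.inr ⟨0, by simp⟩)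
      else .var (σ := Sum.elim (Sum.elim σ fun a : A => a.1.1) [σ i].get) (.inl (.inl j))
    | .inl (.inr a) =>
      .var (σ := Sum.elim (Sum.elim σ fun a : A => a.1.1) [σ i].get) (.inl (.inr a))
    | .inr i => i.elim0) .falsum)) .falsum, fun x => ?_⟩
  rw [Set.mem_ofPred_eq, ← _root_.not_forall_not]
  refine not_congr (forall_congr' fun a => not_congr ?_)
  rw [hφ]
  refine (BFormula.realize_subst _ _ _ _ _ ?_ φ).symm
  rintro ((j | a) | i)
  · by_cases h : i = j
    · subst h
      exact (congrArg (Term.realize _) (dif_pos rfl)).trans (x.update_self i a).symm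
    · exact (congrArg (Term.realize _) (dif_neg h)).trans (x.update_of_ne (Ne.symm h) a).symm
  · rfl
  · exact i.elim0

/-- Tuples may be infinite while only one coordinate can be quantified at a time; finite support
reduces every projection to finitely many quantifiers. -/
theorem DefinableOver.exists_finite_support {D : Set (Tuple M σ)} (hD : DefinableOver A D) :
    ∃ T : Set I, T.Finite ∧ ∀ x y : Tuple M σ, (∀ i ∈ T, x i = y i) → (x ∈ D ↔ y ∈ D) := by
  obtain ⟨φ, hφ⟩ := hD
  obtain ⟨T, hT, h⟩ := BFormula.exists_finite_support (M := M) φ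
  refine ⟨Sum.inl ⁻¹' T, hT.preimage Sum.inl_injective.injOn, fun x y hxy => ?_⟩
  rw [hφ, hφ]
  refine h _ _ _ ?_
  rintro (i | a) hi
  · exact hxy i hi
  · rfl

theorem definableOver_holds_iff {F G : Tuple M σ → Tuple M τ} (hF : IsSubst A F)
    (hG : IsSubst A G) (φ : Formula L τ) :
    DefinableOver A {x | φ.Holds (F x) ↔ φ.Holds (G x)} := by
  have h₁ := (φ.definableOver_holds A).preimage hF
  have h₂ := (φ.definableOver_holds A).preimage hG
  convert (h₁.inter h₂).union (h₁.compl.inter h₂.compl) using 1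
  ext x
  simp only [Set.mem_ofPred_eq, Set.mem_union, Set.mem_inter_iff, Set.mem_preimage,
    Set.mem_compl_iff]
  tauto

/-- Equality of types over `A`, in terms of definable sets. -/
def SameTypeOver (A : Set (Σ s, M s)) (x y : Tuple M σ) : Prop :=
  ∀ D, DefinableOver A D → x ∈ D → y ∈ D

theorem SameTypeOver.mem_iff {x y : Tuple M σ} (h : SameTypeOver A x y) {D : Set (Tuple M σ)}
    (hD : DefinableOver A D) : x ∈ D ↔ y ∈ D :=
  ⟨h D hD, fun hy => by_contra fun hx => h _ hD.compl hx hy⟩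

theorem mk_definable_lt {κ : Cardinal.{u}} (hκ : ℵ₀ < κ) (hL : L.card < κ) (hI : #I < κ)
    (hA : #A < κ) : #{D : Set (Tuple M σ) // DefinableOver A D} < κ := by
  refine lt_of_le_of_lt ?_ (mk_formula_lt hκ hL (V := I ⊕ A) ?_
    (Sum.elim σ fun a : A => a.1.1) [])
  · refine mk_le_of_injective (f := fun D => D.2.choose) fun D D' h =>
      Subtype.ext (Set.ext fun x => ?_)
    have h' := D'.2.choose_spec x
    rw [D.2.choose_spec x, h', show D.2.choose = D'.2.choose from h]
  · simpa using add_lt_of_lt hκ.le hI hA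

/-- Homogeneity over parameters: an enumeration of `A` is adjoined to both tuples. -/
theorem IsMonster.exists_smul_eq {κ : Cardinal.{u}} (hM : IsMonster L M κ) (hI : #I < κ)
    (hA : #A < κ) {x y : Tuple M σ} (h : SameTypeOver A x y) :
    ∃ g : Aut L M, Fixes g A ∧ g • x = y := by
  obtain ⟨g, hg⟩ := hM.homogeneous (I ⊕ A) _ (by simpa using add_lt_of_lt hM.aleph0_lt.le hI hA)
    (x.append (params A)) (y.append (params A)) fun φ =>
      h.mem_iff (D := {x | φ.Holds (x.append (params A))}) ⟨φ, fun _ => Iff.rfl⟩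
  exact ⟨g, fun a ha => congrFun hg (.inr ⟨a, ha⟩), funext fun i => congrFun hg (.inl i)⟩

end Definable

/-! ### Saturation for small tuples -/

section Saturation

variable {L : MSLanguage.{u}} {M : L.Srt → Type u} [L.Structure M]
variable {I J : Type u} {σ : I → L.Srt} {τ : J → L.Srt} {A B : Set (Σ s, M s)} {κ : Cardinal.{u}}

/-- The set of entries of a tuple. -/
def Tuple.entries {S : Type u} {M : S → Type u} {I : Type u} {σ : I → S} (x : Tuple M σ) :
    Set (Σ s, M s) := Set.range fun i => ⟨σ i, x i⟩

theorem Tuple.mk_entries_lt {S : Type u} {M : S → Type u} {I : Type u} {σ : I → S}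
    (x : Tuple M σ) (hI : #I < κ) : #x.entries < κ := mk_range_le.trans_lt hI

theorem Tuple.mem_entries {S : Type u} {M : S → Type u} {I : Type u} {σ : I → S}
    (x : Tuple M σ) (i : I) : (⟨σ i, x i⟩ : Σ s, M s) ∈ x.entries := ⟨i, rfl⟩

theorem IsMonster.mk_union_lt (hM : IsMonster L M κ) (hA : #A < κ) (hB : #B < κ) :
    #(A ∪ B : Set (Σ s, M s)) < κ :=
  (mk_union_le A B).trans_lt (add_lt_of_lt hM.aleph0_lt.le hA hB)

theorem Fixes.smul_eq {g : Aut L M} {x : Tuple M σ} (h : Fixes g x.entries) : g • x = x :=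
  funext fun i => h _ (x.mem_entries i)

theorem fixes_entries {g : Aut L M} {x : Tuple M σ} (h : g • x = x) : Fixes g x.entries := by
  rintro _ ⟨i, rfl⟩
  exact congrFun h i

theorem DefinableOver.exists_eqOn_compl {D : Set (Tuple M σ)} (hD : DefinableOver A D)
    {T : Set I} (hT : T.Finite) : DefinableOver A {x | ∃ y ∈ D, ∀ i ∉ T, x i = y i} := by
  induction T, hT using Set.Finite.induction_on with
  | empty =>
    convert hD using 1
    ext x
    exact ⟨fun ⟨y, hy, h⟩ => (funext fun i => h i id : x = y) ▸ hy, fun h => ⟨x, h, fun _ _ => rfl⟩⟩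
  | @insert j T _ _ ih =>
    convert ih.exists_update j using 1
    ext x
    constructor
    · rintro ⟨y, hy, h⟩
      refine ⟨y j, y, hy, fun i hi => ?_⟩
      by_cases hij : i = j
      · subst hij; rw [Tuple.update_self]
      · rw [Tuple.update_of_ne _ hij]
        exact h i (by simp [hij, hi])
    · rintro ⟨a, y, hy, h⟩
      refine ⟨y, hy, fun i hi => ?_⟩
      rw [← h i fun hi' => hi (Set.mem_insert_of_mem _ hi'), Tuple.update_of_ne]
      rintro rfl
      exact hi (Set.mem_insert _ _)

-- Let `T` be a finite support of `D`. Only the coordinates in `T` outside `S ∪ {i}` need an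
-- existential quantifier; those in `S` are filled with parameters from `a`, and those outside `T`
-- do not matter.
open Classical in
theorem DefinableOver.exists_extension {D : Set (Tuple M σ)} (hD : DefinableOver A D)
    {S : Set I} (a : Tuple M σ) {i : I} (hi : i ∉ S) :
    DefinableOver (A ∪ a.entries)
      {b : Tuple M fun _ : PUnit.{u + 1} => σ i | ∃ x ∈ D, x i = b ⟨⟩ ∧ ∀ j ∈ S, x j = a j} := by
  obtain ⟨T, hT, hTD⟩ := hD.exists_finite_support
  have hG : IsSubst (A ∪ a.entries)
      fun b : Tuple M fun _ : PUnit.{u + 1} => σ i => a.update i (b ⟨⟩) := by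
    intro j
    by_cases hj : j = i
    · subst hj
      simp only [Tuple.update_self]
      exact exists_term_var (σ := fun _ : PUnit.{u + 1} => σ j) _ PUnit.unit
    · simp only [Tuple.update_of_ne _ hj]
      exact exists_term_const (.inr (a.mem_entries j))
  convert ((hD.exists_eqOn_compl (hT.sdiff (t := insert i S))).mono
    Set.subset_union_left).preimage hG using 1
  ext b
  constructor
  · rintro ⟨x, hx, hxi, hxS⟩
    have key : ∀ j ∈ insert i S, a.update i (b ⟨⟩) j = x j := by
      rintro j (rfl | hj)
      · rw [Tuple.update_self, hxi]
      · rw [Tuple.update_of_ne _ (ne_of_mem_of_not_mem hj hi), hxS j hj]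
    refine ⟨fun j => if j ∈ T \ insert i S then x j else a.update i (b ⟨⟩) j,
      (hTD _ _ fun j hj => ?_).1 hx, fun j hj => (if_neg hj).symm⟩
    split_ifs with h
    · rfl
    · exact (key j (by_contra fun h' => h ⟨hj, h'⟩)).symm
  · rintro ⟨y, hy, h⟩
    have key : ∀ j ∈ insert i S, y j = a.update i (b ⟨⟩) j := fun j hj =>
      (h j fun h' => h'.2 hj).symm
    refine ⟨y, hy, (key i (Set.mem_insert _ _)).trans (Tuple.update_self _ _ _), fun j hj => ?_⟩
    rw [key j (Set.mem_insert_of_mem _ hj), Tuple.update_of_ne _ (ne_of_mem_of_not_mem hj hi)]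

open Classical in
/-- Saturation for tuples of small length. -/
theorem IsMonster.nonempty_sInter (hM : IsMonster L M κ) (hI : #I < κ) (hA : #A < κ)
    {F : Set (Set (Tuple M σ))} (hF : ∀ D ∈ F, DefinableOver A D)
    (hfip : ∀ t ⊆ F, t.Finite → (⋂₀ t).Nonempty) : (⋂₀ F).Nonempty := by
  obtain ⟨x₀, -⟩ := hfip ∅ (Set.empty_subset _) Set.finite_empty
  -- Zorn's lemma is applied to partial tuples: a pair `(S, a)` stands for the restriction of `a` to
  -- `S`, and it is good if every finite subfamily is realised by a tuple extending it.
  let Good : Set I × Tuple M σ → Prop := fun p =>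
    ∀ t ⊆ F, t.Finite → ∃ x ∈ ⋂₀ t, ∀ i ∈ p.1, x i = p.2 i
  let r : {p // Good p} → {p // Good p} → Prop := fun p q =>
    p.1.1 ⊆ q.1.1 ∧ ∀ i ∈ p.1.1, p.1.2 i = q.1.2 i
  have htrans : ∀ {p q s}, r p q → r q s → r p s := fun h h' =>
    ⟨h.1.trans h'.1, fun i hi => (h.2 i hi).trans (h'.2 i (h.1 hi))⟩
  obtain ⟨⟨⟨S, a⟩, hS⟩, hmax⟩ := exists_maximal_of_chains_bounded (r := r) (fun c hc => by
    let a : Tuple M σ := fun i =>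
      if h : ∃ p ∈ c, i ∈ p.1.1 then h.choose.1.2 i else x₀ i
    have ha : ∀ p ∈ c, ∀ i ∈ p.1.1, p.1.2 i = a i := by
      intro p hp i hi
      have h : ∃ p ∈ c, i ∈ p.1.1 := ⟨p, hp, hi⟩
      simp only [a, dif_pos h]
      obtain hq := h.choose_spec
      by_cases hpq : p = h.choose
      · rw [← hpq]
      · rcases hc hp hq.1 hpq with h' | h'
        · exact h'.2 i hi
        · exact (h'.2 i hq.2).symm
    refine ⟨⟨(⋃ p ∈ c, p.1.1, a), fun t ht htf => ?_⟩, fun p hp =>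
      ⟨fun i hi => Set.mem_biUnion hp hi, ha p hp⟩⟩
    -- Goodness of the union of a chain: a finite subfamily sees only the coordinates in the finite
    -- set `T`, and the part of `T` covered by the chain is already covered by one member `p`. A
    -- realisation extending `p` may be overwritten by `a` elsewhere on the union.
    obtain ⟨T, hT, hTD⟩ := (DefinableOver.sInter htf fun D hD => hF D (ht hD)).exists_finite_support
    rcases c.eq_empty_or_nonempty with rfl | ⟨p₀, hp₀⟩
    · obtain ⟨x, hx⟩ := hfip t ht htf
      exact ⟨x, hx, by simp⟩
    have hTS : (T ∩ ⋃ p ∈ c, p.1.1).Finite := hT.inter_of_left _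
    obtain ⟨p, hp, hpT⟩ := DirectedOn.exists_mem_subset_of_finset_subset_biUnion
      (f := fun p : {p // Good p} => p.1.1) ⟨p₀, hp₀⟩ (s := hTS.toFinset) (fun p hp q hq => by
        by_cases hpq : p = q
        · exact ⟨p, hp, subset_rfl, hpq ▸ subset_rfl⟩
        · rcases hc hp hq hpq with h' | h'
          · exact ⟨q, hq, h'.1, subset_rfl⟩
          · exact ⟨p, hp, subset_rfl, h'.1⟩) (by simp)
    obtain ⟨x, hx, hxp⟩ := p.2 t ht htf
    refine ⟨fun i => if i ∈ ⋃ p ∈ c, p.1.1 then a i else x i,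
      (hTD _ _ fun i hi => ?_).1 hx, fun i hi => if_pos hi⟩
    split_ifs with h
    · have hi' : i ∈ p.1.1 := hpT (by simpa using ⟨hi, by simpa using h⟩)
      rw [hxp i hi', ha p hp i hi']
    · rfl) htrans
  have hSI : ∀ i, i ∈ S := by
    intro i
    by_contra hi
    -- The possible values at a missing coordinate `i`, one set for each finite subfamily.
    -- One-variable saturation yields a common value, which extends the maximal partial tuple.
    let F' : Set (Set (Tuple M fun _ : PUnit.{u + 1} => σ i)) :=
      {D' | ∃ t ⊆ F, t.Finite ∧ D' = {b | ∃ x ∈ ⋂₀ t, x i = b ⟨⟩ ∧ ∀ j ∈ S, x j = a j}}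
    obtain ⟨b, hb⟩ := hM.saturated (A ∪ a.entries) (hM.mk_union_lt hA (a.mk_entries_lt hI)) (σ i) F'
      (by
        rintro _ ⟨t, ht, htf, rfl⟩
        exact (DefinableOver.sInter htf fun D hD => hF D (ht hD)).exists_extension a hi)
      (by
        intro t ht htf
        have h : ∀ D' ∈ t, ∃ t' ⊆ F, t'.Finite ∧
            D' = {b | ∃ x ∈ ⋂₀ t', x i = b ⟨⟩ ∧ ∀ j ∈ S, x j = a j} := fun D' hD' => ht hD'
        choose! f hf hff hfe using h
        obtain ⟨x, hx, hxS⟩ := hS (⋃ D ∈ t, f D) (Set.iUnion₂_subset hf)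
          (htf.biUnion hff)
        refine ⟨fun _ => x i, fun D hD => ?_⟩
        rw [hfe D hD]
        exact ⟨x, fun D' hD' => hx D' (Set.mem_biUnion hD hD'), rfl, hxS⟩)
    have hgood : Good (insert i S, a.update i (b ⟨⟩)) := by
      intro t ht htf
      obtain ⟨x, hx, hxi, hxS⟩ := hb _ ⟨t, ht, htf, rfl⟩
      refine ⟨x, hx, ?_⟩
      rintro j (rfl | hj)
      · exact hxi.trans (Tuple.update_self _ _ _).symm
      · exact (hxS j hj).trans (Tuple.update_of_ne _ (ne_of_mem_of_not_mem hj hi) _).symm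
    exact hi ((hmax ⟨_, hgood⟩ ⟨Set.subset_insert _ _, fun j hj =>
      (Tuple.update_of_ne _ (ne_of_mem_of_not_mem hj hi) _).symm⟩).1 (Set.mem_insert _ _))
  refine ⟨a, fun D hD => ?_⟩
  obtain ⟨x, hx, hxa⟩ := hS {D} (Set.singleton_subset_iff.2 hD) (Set.finite_singleton D)
  rw [← (funext fun i => hxa i (hSI i) : x = a)]
  exact hx D rfl

end Saturation

/-! ### Closed sets, compactness and projections -/

section Closed

variable {L : MSLanguage.{u}} {M : L.Srt → Type u} [L.Structure M]
variable {I J : Type u} {σ : I → L.Srt} {τ : J → L.Srt} {A B : Set (Σ s, M s)} {κ : Cardinal.{u}}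

/-- `Y` is an intersection of sets definable over `A`. -/
def ClosedOver (A : Set (Σ s, M s)) (Y : Set (Tuple M σ)) : Prop :=
  ∀ x ∉ Y, ∃ D, DefinableOver A D ∧ Y ⊆ D ∧ x ∉ D

theorem DefinableOver.closedOver {D : Set (Tuple M σ)} (hD : DefinableOver A D) :
    ClosedOver A D := fun _ hx => ⟨D, hD, subset_rfl, hx⟩

theorem TypeDefinableOver.closedOver {Y : Set (Tuple M σ)} (hY : TypeDefinableOver κ A Y) :
    ClosedOver A Y := by
  obtain ⟨F, -, hF, rfl⟩ := hY
  intro x hx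
  simp only [Set.mem_sInter, not_forall] at hx
  obtain ⟨D, hD, hxD⟩ := hx
  exact ⟨D, hF D hD, Set.sInter_subset_of_mem hD, hxD⟩

/-- Over a small set there are fewer than `κ` definable sets of small tuples, so the size
restriction in type-definability is automatic. -/
theorem ClosedOver.typeDefinableOver {Y : Set (Tuple M σ)} (hY : ClosedOver A Y)
    (hM : IsMonster L M κ) (hI : #I < κ) (hA : #A < κ) : TypeDefinableOver κ A Y := by
  refine ⟨{D | DefinableOver A D ∧ Y ⊆ D}, ?_, fun D hD => hD.1, ?_⟩
  · exact (mk_le_mk_of_subset (t := {D | DefinableOver A D}) fun D hD => hD.1).trans_lt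
      (mk_definable_lt hM.aleph0_lt hM.card_lt hI hA)
  · refine Set.Subset.antisymm (fun x hx D hD => hD.2 hx) fun x hx => by_contra fun h => ?_
    obtain ⟨D, hD, hYD, hxD⟩ := hY x h
    exact hxD (hx D ⟨hD, hYD⟩)

theorem ClosedOver.mono {Y : Set (Tuple M σ)} (hY : ClosedOver A Y) (hAB : A ⊆ B) :
    ClosedOver B Y := fun x hx =>
  let ⟨D, hD, h⟩ := hY x hx
  ⟨D, hD.mono hAB, h⟩

theorem ClosedOver.smul_mem_iff {Y : Set (Tuple M σ)} (hY : ClosedOver A Y) {g : Aut L M}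
    (hg : Fixes g A) {x : Tuple M σ} : g • x ∈ Y ↔ x ∈ Y := by
  refine not_iff_not.1 ⟨fun h h' => ?_, fun h h' => ?_⟩
  · obtain ⟨D, hD, hYD, hxD⟩ := hY _ h
    exact hxD ((hD.smul_mem_iff hg).2 (hYD h'))
  · obtain ⟨D, hD, hYD, hxD⟩ := hY _ h
    exact hxD ((hD.smul_mem_iff hg).1 (hYD h'))

theorem ClosedOver.sInter {F : Set (Set (Tuple M σ))} (h : ∀ Y ∈ F, ClosedOver A Y) :
    ClosedOver A (⋂₀ F) := by
  intro x hx
  simp only [Set.mem_sInter, not_forall] at hx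
  obtain ⟨Y, hY, hxY⟩ := hx
  obtain ⟨D, hD, hYD, hxD⟩ := h Y hY x hxY
  exact ⟨D, hD, (Set.sInter_subset_of_mem hY).trans hYD, hxD⟩

theorem ClosedOver.inter {Y Z : Set (Tuple M σ)} (hY : ClosedOver A Y) (hZ : ClosedOver A Z) :
    ClosedOver A (Y ∩ Z) := by
  intro x hx
  rcases not_and_or.1 hx with h | h
  · obtain ⟨D, hD, hYD, hxD⟩ := hY x h
    exact ⟨D, hD, Set.inter_subset_left.trans hYD, hxD⟩
  · obtain ⟨D, hD, hYD, hxD⟩ := hZ x h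
    exact ⟨D, hD, Set.inter_subset_right.trans hYD, hxD⟩

theorem ClosedOver.union {Y Z : Set (Tuple M σ)} (hY : ClosedOver A Y) (hZ : ClosedOver A Z) :
    ClosedOver A (Y ∪ Z) := by
  intro x hx
  obtain ⟨D, hD, hYD, hxD⟩ := hY x fun h => hx (.inl h)
  obtain ⟨D', hD', hYD', hxD'⟩ := hZ x fun h => hx (.inr h)
  exact ⟨_, hD.union hD', Set.union_subset_union hYD hYD', by simp [hxD, hxD']⟩

theorem ClosedOver.preimage {Y : Set (Tuple M τ)} (hY : ClosedOver A Y)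
    {F : Tuple M σ → Tuple M τ} (hF : IsSubst A F) : ClosedOver A (F ⁻¹' Y) := by
  intro x hx
  obtain ⟨D, hD, hYD, hxD⟩ := hY (F x) hx
  exact ⟨_, hD.preimage hF, Set.preimage_mono hYD, hxD⟩

/-- The set is the intersection over all `φ` of the definable conditions `φ (F x) ↔ φ (G x)`. -/
theorem closedOver_sameType {F G : Tuple M σ → Tuple M τ} (hF : IsSubst A F)
    (hG : IsSubst A G) : ClosedOver A {x | SameType (F x) (G x)} := by
  intro x hx
  obtain ⟨φ, hφ⟩ := not_forall.1 hx
  exact ⟨_, definableOver_holds_iff hF hG φ, fun y hy => hy φ, hφ⟩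

theorem Fixes.inv {g : Aut L M} (hg : Fixes g A) : Fixes g⁻¹ A := fun a ha =>
  (Equiv.symm_apply_eq (g.1 a.1)).2 (hg a ha).symm

/-- A family of closed sets with the finite intersection property has nonempty intersection. -/
theorem IsMonster.nonempty_sInter_closedOver (hM : IsMonster L M κ) (hI : #I < κ) (hA : #A < κ)
    {F : Set (Set (Tuple M σ))} (hF : ∀ Y ∈ F, ClosedOver A Y)
    (hfip : ∀ t ⊆ F, t.Finite → (⋂₀ t).Nonempty) : (⋂₀ F).Nonempty := by
  obtain ⟨x, hx⟩ := hM.nonempty_sInter hI hA (F := {D | DefinableOver A D ∧ ∃ Y ∈ F, Y ⊆ D})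
    (fun D hD => hD.1) fun t ht htf => by
      have h : ∀ D ∈ t, ∃ Y ∈ F, Y ⊆ D := fun D hD => (ht hD).2
      choose! f hf hfD using h
      obtain ⟨x, hx⟩ := hfip (f '' t) (Set.image_subset_iff.2 hf) (htf.image f)
      exact ⟨x, fun D hD => hfD D hD (hx _ (Set.mem_image_of_mem f hD))⟩
  refine ⟨x, fun Y hY => by_contra fun h => ?_⟩
  obtain ⟨D, hD, hYD, hxD⟩ := hF Y hY x h
  exact hxD (hx D ⟨hD, Y, hY, hYD⟩)

/-- The image of a closed set, if invariant under the automorphisms fixing `B`, is closed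
over `B`. -/
theorem ClosedOver.image (hM : IsMonster L M κ) (hI : #I < κ) (hJ : #J < κ) (hA : #A < κ)
    (hB : #B < κ) {Z : Set (Tuple M σ)} (hZ : ClosedOver A Z) {F : Tuple M σ → Tuple M τ}
    (hF : IsSubst A F) (hinv : ∀ g : Aut L M, Fixes g B → ∀ y ∈ F '' Z, g • y ∈ F '' Z) :
    ClosedOver B (F '' Z) := by
  by_contra hcl
  simp only [ClosedOver, not_forall] at hcl
  obtain ⟨y, hy, hcl⟩ := hcl
  -- If no `B`-definable set separates `y` from the image, then every `B`-definable set around `y`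
  -- meets the image. Compactness gives `z ∈ Z` with `F z` of the same type over `B` as `y`, and an
  -- automorphism fixing `B` puts `y` into the image.
  have hyD : ∀ D, DefinableOver B D → y ∈ D → (Z ∩ F ⁻¹' D).Nonempty := by
    intro D hD hyD
    by_contra hne
    refine hcl ⟨Dᶜ, hD.compl, ?_, fun h => h hyD⟩
    rintro _ ⟨z, hz, rfl⟩ hzD
    exact hne ⟨z, hz, hzD⟩
  obtain ⟨z, hz⟩ := hM.nonempty_sInter_closedOver hI (hM.mk_union_lt hA hB)
    (F := insert Z {Y | ∃ D, DefinableOver B D ∧ y ∈ D ∧ Y = F ⁻¹' D}) (by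
      rintro _ (rfl | ⟨D, hD, -, rfl⟩)
      · exact hZ.mono Set.subset_union_left
      · exact ((hD.mono Set.subset_union_right).preimage
          (hF.mono Set.subset_union_left)).closedOver) (by
      intro t ht htf
      have h : ∀ Y ∈ t \ {Z}, ∃ D, DefinableOver B D ∧ y ∈ D ∧ Y = F ⁻¹' D := fun Y hY =>
        (ht hY.1).resolve_left hY.2
      choose! f hf hyf hYf using h
      obtain ⟨z, hz, hzD⟩ := hyD (⋂₀ (f '' (t \ {Z})))
        (DefinableOver.sInter (htf.sdiff.image f) (by rintro _ ⟨Y, hY, rfl⟩; exact hf Y hY))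
        (by rintro _ ⟨Y, hY, rfl⟩; exact hyf Y hY)
      refine ⟨z, fun Y hY => ?_⟩
      by_cases hYZ : Y = Z
      · rwa [hYZ]
      · rw [hYf Y ⟨hY, hYZ⟩]
        exact hzD _ ⟨Y, ⟨hY, hYZ⟩, rfl⟩)
  obtain ⟨g, hg, hgy⟩ := hM.exists_smul_eq hJ hB (x := y) (y := F z) fun D hD hy' =>
    hz _ (.inr ⟨D, hD, hy', rfl⟩)
  have := hinv g⁻¹ hg.inv _ ⟨z, hz Z (.inl rfl), rfl⟩
  rw [← hgy, inv_smul_smul] at this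
  exact hy this

/-- The image of a set closed over `A` under a map defined over `A` is closed over `A`. -/
theorem ClosedOver.image_self (hM : IsMonster L M κ) (hI : #I < κ) (hJ : #J < κ) (hA : #A < κ)
    {Z : Set (Tuple M σ)} (hZ : ClosedOver A Z) {F : Tuple M σ → Tuple M τ}
    (hF : IsSubst A F) : ClosedOver A (F '' Z) := by
  refine hZ.image hM hI hJ hA hA hF ?_
  rintro g hg _ ⟨z, hz, rfl⟩
  exact ⟨g • z, (hZ.smul_mem_iff hg).2 hz, hF.smul hg z⟩

/-- A closed set is closed over any small set `B` such that it is invariant under the automorphisms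
fixing `B`. -/
theorem ClosedOver.of_invariant (hM : IsMonster L M κ) (hI : #I < κ) (hA : #A < κ)
    (hB : #B < κ) {Z : Set (Tuple M σ)} (hZ : ClosedOver A Z)
    (hinv : ∀ g : Aut L M, Fixes g B → ∀ y ∈ Z, g • y ∈ Z) : ClosedOver B Z := by
  simpa using hZ.image hM hI hI hA hB isSubst_id (by simpa using hinv)

end Closed

/-! ### Elementary submodels: Tarski–Vaught and Löwenheim–Skolem -/

section Models

variable {L : MSLanguage.{u}} {M : L.Srt → Type u} [L.Structure M]
variable {I J : Type u} {σ : I → L.Srt} {τ : J → L.Srt} {A B : Set (Σ s, M s)} {κ : Cardinal.{u}}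

theorem BFormula.definableOver_realize {V : Type u} {ρ : V → L.Srt} {b : List L.Srt}
    (φ : BFormula L ρ b) {v : Tuple M σ → Tuple M ρ} {xs : Tuple M σ → Tuple M b.get}
    (h : ∀ k, ∃ t : Term L (Sum.elim σ fun a : A => a.1.1) (Sum.elim ρ b.get k),
      ∀ x, (v x).append (xs x) k = t.realize (x.append (params A))) :
    DefinableOver A {x | φ.Realize (v x) (xs x)} := by
  choose t ht using h
  refine ⟨φ.subst (b' := []) fun k => (t k).subst fun v =>
    .var (σ := Sum.elim (Sum.elim σ fun a : A => a.1.1) [].get) (.inl v), fun x => ?_⟩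
  refine (BFormula.realize_subst _ _ _ _ _ (fun k => ?_) φ).symm
  exact (Term.realize_subst _ _ (x.append (params A)) (fun v => rfl) (t k)).trans (ht k x).symm

/-- The Tarski–Vaught condition: every nonempty subset of a sort that is definable over `A` meets
`A`. -/
def TarskiVaught (A : Set (Σ s, M s)) : Prop :=
  ∀ (s : L.Srt) (D : Set (Tuple M fun _ : PUnit.{u + 1} => s)), DefinableOver A D → D.Nonempty →
    ∃ x ∈ D, (⟨s, x ⟨⟩⟩ : Σ s, M s) ∈ A

/-- Existential quantification over one variable. -/
def Formula.ex {s : L.Srt} (φ : Formula L (Sum.elim (fun _ : PUnit.{u + 1} => s) σ)) :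
    Formula L σ :=
  .imp (.all s (.imp (BFormula.subst (σ := Sum.elim (fun _ : PUnit.{u + 1} => s) σ) (b' := [s])
    (fun k : (PUnit ⊕ I) ⊕ Fin ([] : List L.Srt).length => match k with
      | .inl (.inl _) => .var (σ := Sum.elim σ [s].get) (.inr ⟨0, by simp⟩)
      | .inl (.inr i) => .var (σ := Sum.elim σ [s].get) (.inl i)
      | .inr i => i.elim0) φ) .falsum)) .falsum

theorem Formula.holds_ex {s : L.Srt} (φ : Formula L (Sum.elim (fun _ : PUnit.{u + 1} => s) σ))
    (v : Tuple M σ) :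
    φ.ex.Holds v ↔ ∃ x : Tuple M (fun _ : PUnit.{u + 1} => s), φ.Holds (x.append v) := by
  refine Iff.trans (b := ∃ a : M s,
    φ.Holds (Tuple.append (σ := fun _ : PUnit.{u + 1} => s) (fun _ => a) v)) ?_
    ⟨fun ⟨a, h⟩ => ⟨_, h⟩, fun ⟨x, h⟩ => ⟨x ⟨⟩, h⟩⟩
  rw [← _root_.not_forall_not]
  refine not_congr (forall_congr' fun a => not_congr ?_)
  refine BFormula.realize_subst _ _ _ _ _ ?_ φ
  rintro ((j | i) | i)
  · rfl
  · rfl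
  · exact i.elim0

/-- Parameters become free variables evaluated at `e`, which is the form in which an elementary
embedding can transfer a formula. -/
theorem DefinableOver.exists_formula_of_subset_entries {D : Set (Tuple M σ)}
    (hD : DefinableOver A D) (e : Tuple M τ) (hA : A ⊆ e.entries) :
    ∃ ψ : Formula L (Sum.elim σ τ), ∀ x, x ∈ D ↔ ψ.Holds (x.append e) := by
  obtain ⟨φ, hφ⟩ := hD
  have h : ∀ a : A, ∃ t : Term L (Sum.elim (Sum.elim σ τ) [].get) a.1.1,
      ∀ x : Tuple M σ, t.realize ((x.append e).append fun i : Fin 0 => i.elim0) = a.1.2 := by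
    rintro ⟨a, ha⟩
    obtain ⟨i, rfl⟩ := hA ha
    exact ⟨.var (σ := Sum.elim (Sum.elim σ τ) [].get) (.inl (.inr i)), fun _ => rfl⟩
  choose t ht using h
  refine ⟨φ.subst (σ := Sum.elim σ fun a : A => a.1.1) (b' := [])
    fun k : (I ⊕ A) ⊕ Fin ([] : List L.Srt).length => match k with
    | .inl (.inl i) => .var (σ := Sum.elim (Sum.elim σ τ) [].get) (.inl (.inl i))
    | .inl (.inr a) => t a
    | .inr i => i.elim0, fun x => ?_⟩
  rw [hφ]
  refine (BFormula.realize_subst _ _ _ _ _ ?_ φ).symm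
  rintro ((j | a) | i)
  · rfl
  · exact ht a x
  · exact i.elim0

theorem IsElementary.tarskiVaught {N : L.Srt → Type u} [L.Structure N] {j : ∀ s, N s → M s}
    (hj : IsElementary j) : TarskiVaught (enumTuple j).entries := by
  rintro s D hD ⟨x, hx⟩
  obtain ⟨ψ, hψ⟩ := hD.exists_formula_of_subset_entries (enumTuple j) subset_rfl
  let e : Tuple N (Sigma.fst : (Σ s, N s) → L.Srt) := fun a => a.2
  obtain ⟨y, hy⟩ := (ψ.holds_ex e).1 ((hj _ _ _ e).1 ((ψ.holds_ex _).2 ⟨x, (hψ x).1 hx⟩))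
  refine ⟨fun i => j s (y i), (hψ _).2 ?_, (enumTuple j).mem_entries ⟨s, y ⟨⟩⟩⟩
  refine (iff_of_eq (congrArg ψ.Holds (funext fun k => ?_))).2 ((hj _ _ _ (y.append e)).2 hy)
  rcases k with k | k <;> rfl

/-- The elementary substructure given by a set satisfying the Tarski–Vaught condition. -/
theorem TarskiVaught.exists_isElementary (hA : TarskiVaught A) (hκ : #A < κ) :
    ∃ (N : L.Srt → Type u) (_ : L.Structure N) (j : ∀ s, N s → M s),
      IsElementary j ∧ #(Σ s, N s) < κ ∧ (enumTuple j).entries = A := by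
  let N : L.Srt → Type u := fun s => {a : M s // (⟨s, a⟩ : Σ s, M s) ∈ A}
  have hf : ∀ (f : L.Fn) (x : Tuple N (L.fnDom f)),
      (⟨L.fnCod f, Structure.funMap f fun i => (x i).1⟩ : Σ s, M s) ∈ A := by
    intro f x
    -- Closure under functions is the Tarski–Vaught condition for the one-element set containing the
    -- value.
    obtain ⟨y, hy, hyA⟩ := hA (L.fnCod f) {y | y ⟨⟩ = Structure.funMap f fun i => (x i).1}
      ⟨.equal (s := L.fnCod f)
        (.var (σ := Sum.elim (Sum.elim (fun _ : PUnit.{u + 1} => L.fnCod f)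
          fun a : A => a.1.1) [].get) (.inl (.inl ⟨⟩)))
        (.app f fun i => .var (σ := Sum.elim (Sum.elim (fun _ : PUnit.{u + 1} => L.fnCod f)
          fun a : A => a.1.1) [].get) (.inl (.inr ⟨_, (x i).2⟩))), fun _ => Iff.rfl⟩
      ⟨fun _ => _, rfl⟩
    rwa [show y ⟨⟩ = _ from hy] at hyA
  let iN : L.Structure N :=
    { funMap := fun f x => ⟨_, hf f x⟩
      relMap := fun r x => Structure.relMap r fun i => (x i).1 }
  let j : ∀ s, N s → M s := fun s a => a.1
  have hterm : ∀ {V : Type u} {ρ : V → L.Srt} {s : L.Srt} (t : Term L ρ s) (v : Tuple N ρ)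
      (w : Tuple M ρ), (∀ i, w i = j _ (v i)) → t.realize w = j s (t.realize v) := by
    intro V ρ s t v w hvw
    induction t with
    | var x => exact hvw x
    | app f ts ih =>
      simp only [Term.realize, ih]
      rfl
  have hform : ∀ {V : Type u} {ρ : V → L.Srt} {b : List L.Srt} (φ : BFormula L ρ b) (v : Tuple N ρ)
      (xs : Tuple N b.get), φ.Realize (fun i => j _ (v i) : Tuple M ρ) (fun i => j _ (xs i)) ↔
        φ.Realize v xs := by
    intro V ρ b φ v xs
    have happ : ∀ {b : List L.Srt} (xs : Tuple N b.get) (k : V ⊕ Fin b.length),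
        Tuple.append (fun i => j _ (v i) : Tuple M ρ) (fun i => j _ (xs i) : Tuple M b.get) k =
          j _ (v.append xs k) := by
      rintro b xs (i | i) <;> rfl
    induction φ with
    | falsum => rfl
    | equal t₁ t₂ =>
      simp only [BFormula.Realize, hterm _ _ _ (happ xs)]
      exact Subtype.ext_iff.symm
    | rel r ts =>
      simp only [BFormula.Realize, hterm _ _ _ (happ xs)]
      rfl
    | imp φ ψ ih₁ ih₂ => simp only [BFormula.Realize, ih₁, ih₂]
    | @all b s φ ih =>
      have hcons : ∀ a : N s, (fun i => j _ (Tuple.cons a xs i) : Tuple M (s :: b).get) =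
          Tuple.cons (j s a) (fun i => j _ (xs i) : Tuple M b.get) := by
        intro a
        funext i
        rcases i with ⟨_ | i, hi⟩ <;> rfl
      simp only [BFormula.Realize]
      refine ⟨fun h a => ?_, fun h => ?_⟩
      · refine (ih _).1 ?_
        rw [hcons]
        exact h _
      -- A counterexample in `M` may be replaced by one in `A`, by the Tarski–Vaught condition for
      -- the complement.
      · by_contra! hne
        obtain ⟨a, ha⟩ := hne
        obtain ⟨x, hx, hxA⟩ := hA s
          {x | φ.Realize (fun i => j _ (v i) : Tuple M ρ)
            (Tuple.cons (x ⟨⟩) (fun i => j _ (xs i) : Tuple M b.get))}ᶜ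
          (DefinableOver.compl (φ.definableOver_realize (by
            rintro (i | ⟨_ | i, hi⟩)
            · exact exists_term_const (v i).2
            · exact exists_term_var (σ := fun _ : PUnit.{u + 1} => s) _ PUnit.unit
            · exact exists_term_const (xs ⟨i, _⟩).2)))
          ⟨fun _ => a, ha⟩
        refine hx ?_
        have := (ih _).2 (h ⟨x ⟨⟩, hxA⟩)
        rwa [hcons] at this
  refine ⟨N, iN, j, fun V ρ φ v => ?_, ?_, ?_⟩
  · refine Iff.trans (iff_of_eq ?_) (hform φ v fun i : Fin 0 => i.elim0)
    exact congrArg (BFormula.Realize _ φ) (funext fun i => i.elim0)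
  · refine (mk_le_of_injective (f := fun a : Σ s, N s =>
      (⟨⟨a.1, a.2.1⟩, a.2.2⟩ : A)) ?_).trans_lt hκ
    rintro ⟨s, a, ha⟩ ⟨s', a', ha'⟩ h
    cases h
    rfl
  · ext ⟨s, a⟩
    refine ⟨?_, fun h => ⟨⟨s, a, h⟩, rfl⟩⟩
    rintro ⟨⟨s', a', h⟩, h'⟩
    cases h'
    exact h

/-- Parameters outside the finite support are irrelevant to truth but still occur as variables; each
is replaced by an arbitrary element of `B` of the same sort. This is why `B` has to meet every
nonempty sort. -/
theorem DefinableOver.exists_finite_params {D : Set (Tuple M σ)} (hD : DefinableOver A D) :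
    ∃ T ⊆ A, T.Finite ∧ ∀ B, T ⊆ B → (∀ s (_ : M s), ∃ b : M s, (⟨s, b⟩ : Σ s, M s) ∈ B) →
      DefinableOver B D := by
  obtain ⟨φ, hφ⟩ := definableOver_iff.1 hD
  obtain ⟨T, hT, h⟩ := BFormula.exists_finite_support (M := M) φ
  refine ⟨Subtype.val '' (Sum.inr ⁻¹' T : Set A), ?_,
    (hT.preimage Sum.inr_injective.injOn).image _, fun B hTB hB => ?_⟩
  · rintro _ ⟨a, -, rfl⟩
    exact a.2
  have hc : ∀ a : A, ∃ c : M a.1.1, (⟨a.1.1, c⟩ : Σ s, M s) ∈ B ∧ (a.1 ∈ B → c = a.1.2) := by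
    intro a
    by_cases ha : a.1 ∈ B
    · exact ⟨a.1.2, ha, fun _ => rfl⟩
    · obtain ⟨c, hc⟩ := hB _ a.1.2
      exact ⟨c, hc, fun h => (ha h).elim⟩
  choose c hcB hc using hc
  convert BFormula.definableOver_realize (A := B) φ
    (v := fun x : Tuple M σ => x.append (τ := fun a : A => a.1.1) c)
    (xs := fun _ => fun i : Fin 0 => i.elim0) ?_ using 1
  · ext x
    refine (hφ x).trans (h _ _ _ ?_)
    rintro (i | a) ha
    · rfl
    · exact (hc a (hTB ⟨a, ha, rfl⟩)).symm
  · rintro ((i | a) | i)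
    · exact exists_term_var _ i
    · exact exists_term_const (hcB a)
    · exact i.elim0

/-- A small set satisfying the Tarski–Vaught condition (downward Löwenheim–Skolem). -/
theorem IsMonster.exists_tarskiVaught (hM : IsMonster L M κ) :
    ∃ A : Set (Σ s, M s), #A < κ ∧ TarskiVaught A := by
  -- The strong limit `κ` may be singular, so sizes are bounded by a regular cardinal `μ ≤ κ`.
  let μ : Cardinal.{u} := Order.succ (max ℵ₀ L.card)
  have hμ : μ.IsRegular := isRegular_succ (le_max_left _ _)
  have hμ0 : ℵ₀ < μ := Order.lt_succ_of_le (le_max_left _ _)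
  have hμL : L.card < μ := Order.lt_succ_of_le (le_max_right _ _)
  have hμκ : μ ≤ κ := Order.succ_le_of_lt (max_lt hM.aleph0_lt hM.card_lt)
  let W : Set (Σ s, M s) → Set (Σ s, M s) := fun A => A ∪ Set.range
    fun p : Σ s, {D : {D : Set (Tuple M fun _ : PUnit.{u + 1} => s) // DefinableOver A D} //
      D.1.Nonempty} => ⟨p.1, p.2.2.choose ⟨⟩⟩
  have hW : ∀ A : Set (Σ s, M s), #A < μ → #(W A) < μ := by
    intro A hA
    refine (mk_union_le _ _).trans_lt (add_lt_of_lt hμ0.le hA (mk_range_le.trans_lt ?_))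
    rw [mk_sigma]
    refine sum_lt_of_isRegular hμ ((le_self_add.trans le_self_add).trans_lt hμL) fun s => ?_
    refine (mk_subtype_le _).trans_lt (mk_definable_lt hμ0 hμL ?_ hA)
    simpa using one_lt_aleph0.trans hμ0
  have hWD : ∀ A s (D : Set (Tuple M fun _ : PUnit.{u + 1} => s)), DefinableOver A D →
      D.Nonempty → ∃ x ∈ D, (⟨s, x ⟨⟩⟩ : Σ s, M s) ∈ W A := fun A s D hD hne =>
    ⟨hne.choose, hne.choose_spec, .inr ⟨⟨s, ⟨⟨D, hD⟩, hne⟩⟩, rfl⟩⟩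
  let S : ℕ → Set (Σ s, M s) := fun n => W^[n] ∅
  have hS : ∀ n, S (n + 1) = W (S n) := fun n => Function.iterate_succ_apply' W n ∅
  have hmono : Monotone S := monotone_nat_of_le_succ fun n => by
    rw [hS]; exact Set.subset_union_left
  have hcard : ∀ n, #(S n) < μ := by
    intro n
    induction n with
    | zero => simpa [S] using hμ.pos
    | succ n ih => rw [hS]; exact hW _ ih
  refine ⟨⋃ n, S n, lt_of_lt_of_le ?_ hμκ, fun s D hD hne => ?_⟩
  · rw [← Equiv.ulift.{u}.surjective.iUnion_comp]
    exact (card_iUnion_lt_iff_forall_of_isRegular hμ (by simpa using hμ0)).2 fun n => hcard _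
  · obtain ⟨T, hTS, hT, hTD⟩ := hD.exists_finite_params
    obtain ⟨n, hn⟩ := Directed.exists_mem_subset_of_finset_subset_biUnion
      (hmono.directed_le) (s := hT.toFinset) (by simpa using hTS)
    rw [hT.coe_toFinset] at hn
    -- Stage `n + 1` rather than `n`: it contains witnesses for the full sorts, hence meets every
    -- nonempty sort.
    obtain ⟨x, hx, hxS⟩ := hWD (S (n + 1)) s D (hTD _ (hn.trans (hmono n.le_succ)) fun s a => by
      obtain ⟨x, -, hx⟩ := hWD (S n) s Set.univ definableOver_univ ⟨fun _ => a, trivial⟩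
      exact ⟨x ⟨⟩, by rwa [hS]⟩) hne
    rw [← hS] at hxS
    exact ⟨x, hx, Set.mem_iUnion.2 ⟨_, hxS⟩⟩

end Models

/-! ### Lascar strong automorphisms and bounded invariant relations -/

section Lascar

variable {L : MSLanguage.{u}} {M : L.Srt → Type u} [L.Structure M]
variable {I J : Type u} {σ : I → L.Srt} {τ : J → L.Srt} {A B : Set (Σ s, M s)} {κ : Cardinal.{u}}

/-- Nonempty `A`-definable sets of tuples contain tuples from `A`, if `A` satisfies the
Tarski–Vaught condition. -/
theorem TarskiVaught.exists_entries_subset (hA : TarskiVaught A) {D : Set (Tuple M σ)}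
    (hD : DefinableOver A D) (hne : D.Nonempty) : ∃ x ∈ D, x.entries ⊆ A := by
  obtain ⟨T, hT, hTD⟩ := hD.exists_finite_support
  induction T, hT using Set.Finite.induction_on generalizing D with
  | empty =>
    obtain ⟨x, hx⟩ := hne
    choose y _ hy using fun i => hA (σ i) Set.univ definableOver_univ ⟨fun _ => x i, trivial⟩
    refine ⟨fun i => y i ⟨⟩, (hTD _ _ (by simp)).1 hx, ?_⟩
    rintro _ ⟨i, rfl⟩
    exact hy i
  | @insert i T _ _ ih =>
    obtain ⟨x, hx⟩ := hne
    -- The coordinate `i` is quantified away, the remaining ones are found in `A` by induction, and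
    -- then the `i`-th is found with the others as parameters.
    obtain ⟨y, ⟨a, hya⟩, hyA⟩ := ih (hD.exists_update i) ⟨x, x i, by
      convert hx using 1
      funext j
      by_cases hj : j = i
      · subst hj; rw [Tuple.update_self]
      · rw [Tuple.update_of_ne _ hj]⟩ (fun x y hxy => by
        refine exists_congr fun a => hTD _ _ fun j hj => ?_
        by_cases h : j = i
        · subst h; rw [Tuple.update_self, Tuple.update_self]
        · rw [Tuple.update_of_ne _ h, Tuple.update_of_ne _ h]
          exact hxy j (hj.resolve_left h))
    obtain ⟨b, hb, hbA⟩ := hA (σ i) {b | y.update i (b ⟨⟩) ∈ D} (hD.preimage fun j => by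
      by_cases hj : j = i
      · subst hj
        simp only [Tuple.update_self]
        exact exists_term_var (σ := fun _ : PUnit.{u + 1} => σ j) _ PUnit.unit
      · simp only [Tuple.update_of_ne _ hj]
        exact exists_term_const (hyA (y.mem_entries j))) ⟨fun _ => a, hya⟩
    refine ⟨_, hb, ?_⟩
    rintro _ ⟨j, rfl⟩
    by_cases hj : j = i
    · subst hj
      simp only [Tuple.update_self]
      exact hbA
    · simp only [Tuple.update_of_ne _ hj]
      exact hyA (y.mem_entries j)

/-- An ultrafilter containing the type of `x` over `A` and concentrated on tuples from `A`. -/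
theorem TarskiVaught.exists_ultrafilter (hA : TarskiVaught A) (x : Tuple M σ) :
    ∃ U : Ultrafilter (Tuple M σ), {n : Tuple M σ | n.entries ⊆ A} ∈ U ∧
      ∀ D, DefinableOver A D → x ∈ D → D ∈ U := by
  obtain ⟨U, hU⟩ := Ultrafilter.exists_ultrafilter_of_finite_inter_nonempty
    {Y | ∃ D, DefinableOver A D ∧ x ∈ D ∧ Y = D ∩ {n : Tuple M σ | n.entries ⊆ A}} fun T hT => by
      have h : ∀ Y ∈ T, ∃ D, DefinableOver A D ∧ x ∈ D ∧
        Y = D ∩ {n : Tuple M σ | n.entries ⊆ A} := fun Y hY => hT hY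
      choose! f hf hxf hYf using h
      obtain ⟨n, hn, hnA⟩ := hA.exists_entries_subset (D := ⋂₀ (f '' T))
        (DefinableOver.sInter (T.finite_toSet.image f) (by rintro _ ⟨Y, hY, rfl⟩; exact hf Y hY))
        ⟨x, by rintro _ ⟨Y, hY, rfl⟩; exact hxf Y hY⟩
      refine ⟨n, fun Y hY => ?_⟩
      rw [hYf Y hY]
      exact ⟨hn _ ⟨Y, hY, rfl⟩, hnA⟩
  exact ⟨U,
    Filter.mem_of_superset (hU ⟨_, definableOver_univ, trivial, rfl⟩) Set.inter_subset_right,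
    fun D hD hx => Filter.mem_of_superset (hU ⟨D, hD, hx, rfl⟩) Set.inter_subset_left⟩

/-- The `B`-definable members of an ultrafilter form a finitely satisfiable complete type over `B`.
-/
theorem IsMonster.exists_realization (hM : IsMonster L M κ) (hI : #I < κ) (hB : #B < κ)
    (U : Ultrafilter (Tuple M σ)) : ∃ z, ∀ D, DefinableOver B D → (z ∈ D ↔ D ∈ U) := by
  obtain ⟨z, hz⟩ := hM.nonempty_sInter hI hB (F := {D | DefinableOver B D ∧ D ∈ U})
    (fun D hD => hD.1) fun t ht htf =>
      U.nonempty_of_mem ((Filter.sInter_mem htf).2 fun D hD => (ht hD).2)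
  refine ⟨z, fun D hD => ⟨fun h => by_contra fun hU => ?_, fun h => hz D ⟨hD, h⟩⟩⟩
  exact hz Dᶜ ⟨hD.compl, Ultrafilter.compl_mem_iff_notMem.2 hU⟩ h

theorem isSubst_append_const {c : Tuple M τ} (hc : c.entries ⊆ A) :
    IsSubst A fun z : Tuple M σ => z.append c := by
  rintro (i | i)
  · exact exists_term_var _ i
  · exact exists_term_const (hc (c.mem_entries i))

open Classical in
/-- A bounded invariant equivalence relation is preserved by the automorphisms which fix a small
elementary submodel pointwise. -/
theorem TarskiVaught.rel_smul (hA : TarskiVaught A) (hM : IsMonster L M κ) (hI : #I < κ)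
    (hAκ : #A < κ) {Y : Type u} [MulAction (Aut L M) Y] {ι : Y → Tuple M σ}
    (hι : Function.Injective ι) (hsmul : ∀ (g : Aut L M) y, ι (g • y) = g • ι y) {E : Setoid Y}
    (hinv : IsInvariantRel (Aut L M) E) (hbdd : #(Quotient E) < κ) {g : Aut L M} (hg : Fixes g A)
    (y : Y) : E y (g • y) := by
  -- For each class met by the orbit of `y` under the stabiliser of `A`, `r` chooses an automorphism
  -- leading into it. Boundedness keeps the set `B` of all entries of these representatives small.
  let r : Quotient E → Aut L M := fun q =>
    if h : ∃ h : Aut L M, Fixes h A ∧ Quotient.mk E (h • y) = q then h.choose else 1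
  let B : Set (Σ s, M s) := A ∪ (Set.range fun p : Quotient E × I =>
    (⟨σ p.2, ι (r p.1 • y) p.2⟩ : Σ s, M s)) ∪ (ι y).entries ∪ (ι (g • y)).entries
  have hB : #B < κ := by
    refine hM.mk_union_lt (hM.mk_union_lt (hM.mk_union_lt hAκ (mk_range_le.trans_lt ?_))
      (Tuple.mk_entries_lt _ hI)) (Tuple.mk_entries_lt _ hI)
    simpa using mul_lt_of_lt hM.aleph0_lt.le hbdd hI
  -- A coheir: `z` realises over `B` a type finitely satisfiable in `A` that extends the type of `y`
  -- over `A`, so `z = h • y` with `h` fixing `A`.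
  obtain ⟨U, hUA, hU⟩ := hA.exists_ultrafilter (ι y)
  obtain ⟨z, hz⟩ := hM.exists_realization hI hB U
  have hAB : A ⊆ B := fun a ha => .inl (.inl (.inl ha))
  obtain ⟨h, hh, rfl⟩ := hM.exists_smul_eq hI hAκ (x := ι y) (y := z) fun D hD hy =>
    (hz D (hD.mono hAB)).2 (hU D hD hy)
  rw [← hsmul] at hz
  -- The coheir cannot distinguish `k • y` from `y`: `U` concentrates on tuples `n` from `A`, which
  -- `k` fixes, so `(n, k • y)` and `(n, y)` have the same type. Hence so do `(h • y, k • y)` and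
  -- `(h • y, y)`.
  have key : ∀ k : Aut L M, Fixes k A → (ι (k • y)).entries ⊆ B →
      (E (h • y) (k • y) ↔ E (h • y) y) := by
    intro k hk hkB
    have hII : #(I ⊕ I) < κ := by simpa using add_lt_of_lt hM.aleph0_lt.le hI hI
    obtain ⟨f, -, hf⟩ := hM.exists_smul_eq (A := ∅) hII (by simpa using hM.aleph0_lt.bot_lt)
      (x := (ι (h • y)).append (ι (k • y))) (y := (ι (h • y)).append (ι y)) fun D hD hmem => by
        have h₁ := (hz _ ((hD.mono (Set.empty_subset B)).preimage
          (isSubst_append_const hkB))).1 hmem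
        refine (hz _ ((hD.mono (Set.empty_subset B)).preimage (isSubst_append_const
          fun a ha => .inl (.inr ha)))).2 ?_
        filter_upwards [h₁, hUA] with n hn hnA
        rw [Set.mem_preimage, hsmul] at hn
        rw [Set.mem_preimage, ← hD.smul_mem_iff (g := k) (fun a ha => ha.elim), ← append_smul,
          (hk.mono hnA).smul_eq]
        exact hn
    have h₁ : f • h • y = h • y := hι ((hsmul _ _).trans (funext fun i => congrFun hf (.inl i)))
    have h₂ : f • k • y = y := hι ((hsmul _ _).trans (funext fun i => congrFun hf (.inr i)))
    rw [hinv f, h₁, h₂]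
  have hex : ∃ h' : Aut L M, Fixes h' A ∧ Quotient.mk E (h' • y) = Quotient.mk E (h • y) :=
    ⟨h, hh, rfl⟩
  have hr : r (Quotient.mk E (h • y)) = hex.choose := dif_pos hex
  -- The representative of the class of `h • y` lies in `B` and is equivalent to `h • y`; by `key`
  -- so is `y`, and then, by `key` again, `g • y`.
  have hry := (key (r (Quotient.mk E (h • y))) (hr ▸ hex.choose_spec.1) (by
    rintro _ ⟨i, rfl⟩
    exact .inl (.inl (.inr ⟨(_, i), rfl⟩)))).1 (by
      rw [hr]
      exact E.symm (Quotient.exact hex.choose_spec.2))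
  exact E.trans (E.symm hry) ((key g hg fun a ha => .inr ha).2 hry)

theorem TarskiVaught.mem_autfL (hA : TarskiVaught A) (hAκ : #A < κ) {g : Aut L M}
    (hg : Fixes g A) : g ∈ AutfL L M κ := by
  obtain ⟨N, iN, j, hj, hN, rfl⟩ := hA.exists_isElementary hAκ
  exact Subgroup.subset_closure ⟨N, iN, j, hj, hN, hg.smul_eq⟩

/-- Lascar strong automorphisms preserve the classes of bounded invariant equivalence relations. -/
theorem IsMonster.rel_smul (hM : IsMonster L M κ) (hI : #I < κ)
    {Y : Type u} [MulAction (Aut L M) Y] {ι : Y → Tuple M σ}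
    (hι : Function.Injective ι) (hsmul : ∀ (g : Aut L M) y, ι (g • y) = g • ι y) {E : Setoid Y}
    (hinv : IsInvariantRel (Aut L M) E) (hbdd : #(Quotient E) < κ) {g : Aut L M}
    (hg : g ∈ AutfL L M κ) (y : Y) : E y (g • y) := by
  induction hg using Subgroup.closure_induction generalizing y with
  | mem g hg =>
    obtain ⟨N, iN, j, hj, hN, hg⟩ := hg
    exact hj.tarskiVaught.rel_smul hM hI (Tuple.mk_entries_lt _ hN) hι hsmul hinv hbdd
      (fixes_entries hg) y
  | one => rw [one_smul]
  | mul a b _ _ iha ihb => rw [mul_smul]; exact E.trans (ihb y) (iha _)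
  | inv a _ ih => exact E.symm (by simpa using ih (a⁻¹ • y))

/-- The classes of `≡_L` are the orbits of the group of Lascar strong automorphisms. -/
theorem IsMonster.lascarEquiv_iff (hM : IsMonster L M κ) (hI : #I < κ) {x y : Tuple M σ} :
    LascarEquiv κ x y ↔ ∃ g ∈ AutfL L M κ, g • x = y := by
  constructor
  · intro h
    have hinv : IsInvariantRel (Aut L M) (MulAction.orbitRel (AutfL L M κ) (Tuple M σ)) := by
      intro g x y
      simp only [MulAction.orbitRel_apply, MulAction.mem_orbit_iff]
      constructor
      · rintro ⟨f, rfl⟩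
        refine ⟨⟨g * f * g⁻¹, Subgroup.Normal.conj_mem inferInstance _ f.2 _⟩, ?_⟩
        simp [Subgroup.smul_def, mul_smul]
      · rintro ⟨f, hf⟩
        refine ⟨⟨g⁻¹ * f * g, by simpa using
          Subgroup.Normal.conj_mem (H := AutfL L M κ) inferInstance _ f.2 g⁻¹⟩, ?_⟩
        simp only [Subgroup.smul_def] at hf ⊢
        rw [mul_smul, mul_smul, hf, inv_smul_smul]
    -- Tuples of the same type over a small model `A` are conjugate under its stabiliser, so an
    -- orbit is determined by a set of `A`-definable sets. Here `κ` being a strong limit is used.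
    have hbdd : #(Quotient (MulAction.orbitRel (AutfL L M κ) (Tuple M σ))) < κ := by
      obtain ⟨A, hA, hAT⟩ := hM.exists_tarskiVaught
      refine (mk_le_of_injective (f := fun q : Quotient (MulAction.orbitRel (AutfL L M κ)
        (Tuple M σ)) => {D : {D : Set (Tuple M σ) // DefinableOver A D} | q.out ∈ D.1})
        fun q q' hqq => ?_).trans_lt (mk_set.trans_lt (hM.strongLimit.isStrongPrelimit
          (mk_definable_lt hM.aleph0_lt hM.card_lt hI hA)))
      obtain ⟨g, hg, hgq⟩ := hM.exists_smul_eq hI hA (x := q'.out) (y := q.out) fun D hD hq =>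
        (Set.ext_iff.1 hqq ⟨D, hD⟩).2 hq
      rw [← q.out_eq, ← q'.out_eq]
      exact Quotient.sound ⟨⟨g, hAT.mem_autfL hA hg⟩, hgq⟩
    obtain ⟨g, hg⟩ := MulAction.orbitRel_apply.1 ((MulAction.orbitRel _ _).symm (h _ hinv hbdd))
    exact ⟨g.1, g.2, hg⟩
  · rintro ⟨g, hg, rfl⟩ E hinv hbdd
    exact hM.rel_smul hI (ι := id) Function.injective_id (fun _ _ => rfl) hinv hbdd hg x

end Lascar

end MSLanguage

/-! ### Enlarging witnesses of weak orbitality -/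

section Abstract

variable {G : Type*} [Group G] {X : Type*} [MulAction G X] {E : Setoid X}

/-- The elements of `G` fixing all `E`-classes which meet `X'`. -/
def IsInvariantRel.classStabilizer (hinv : IsInvariantRel G E) (X' : Set X) : Subgroup G where
  carrier := {h | ∀ x ∈ X', E x (h • x)}
  one_mem' := fun x _ => by rw [one_smul]
  mul_mem' := fun {a b} ha hb x hx => by
    rw [mul_smul]
    exact E.trans (ha x hx) ((hinv a _ _).1 (hb x hx))
  inv_mem' := fun {a} ha x hx => E.symm ((hinv a _ _).2 (by simpa using ha x hx))

theorem IsWitnessPair.rel_smul {H : Subgroup G} {X' : Set X} (h : IsWitnessPair E H X') {g : G}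
    (hg : g ∈ H) {x : X} (hx : x ∈ X') : E x (g • x) :=
  (h _ _).2 ⟨1, g⁻¹, H.inv_mem hg, by simp, by simpa using hx⟩

/-- The relation `R_{H, X'}` grows with `H` and `X'`; `hE` together with invariance keeps it inside
`E`. -/
theorem IsWitnessPair.of_le (hinv : IsInvariantRel G E) {H H' : Subgroup G} {X' X'' : Set X}
    (h : IsWitnessPair E H X') (hH : H ≤ H') (hX : X' ⊆ X'')
    (hE : ∀ g ∈ H', ∀ x ∈ X'', E x (g • x)) : IsWitnessPair E H' X'' := by
  refine fun x y => ⟨fun hxy => ?_, ?_⟩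
  · obtain ⟨g, k, hk, h₁, h₂⟩ := (h x y).1 hxy
    exact ⟨g, k, hH hk, h₁, hX h₂⟩
  · rintro ⟨g, k, hk, h₁, h₂⟩
    have := hE k⁻¹ (H'.inv_mem hk) _ h₂
    rw [h₁, inv_smul_smul, ← h₁] at this
    exact (hinv g _ _).2 this

/-- The stabiliser of the classes meeting `X'` contains the group and is itself a witness with `X'`,
so maximality forces equality. -/
theorem IsMaxGroupWitness.eq_classStabilizer (hinv : IsInvariantRel G E) {H : Subgroup G}
    (h : IsMaxGroupWitness E H) : ∃ X', H = hinv.classStabilizer X' := by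
  obtain ⟨X', hX', hmax⟩ := h
  have hle : H ≤ hinv.classStabilizer X' := fun g hg x hx => hX'.rel_smul hg hx
  exact ⟨X', by_contra fun hne => hmax _ (lt_of_le_of_ne hle hne)
    (hX'.of_le hinv hle subset_rfl fun g hg x hx => hg x hx)⟩

theorem IsMaxSetWitness.eq_fixed (hinv : IsInvariantRel G E) {X' : Set X}
    (h : IsMaxSetWitness G E X') : ∃ H : Subgroup G, X' = {x | ∀ g ∈ H, E x (g • x)} := by
  obtain ⟨H, hH, hmax⟩ := h
  have hle : X' ⊆ {x | ∀ g ∈ H, E x (g • x)} := fun x hx g hg => hH.rel_smul hg hx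
  exact ⟨H, by_contra fun hne => hmax _ (lt_of_le_of_ne hle hne)
    (hH.of_le hinv le_rfl hle fun g hg x hx => hx g hg)⟩

/-- The set is enlarged first, to all points whose class `H` fixes, and then the group, to the
stabiliser of these classes. The set is maximal with respect to the original `H`, the group with
respect to the enlarged set, and the two enlarged objects still form a witness pair. -/
theorem IsWeaklyOrbital.exists_max (hinv : IsInvariantRel G E) (h : IsWeaklyOrbital G E) :
    ∃ (H : Subgroup G) (X' : Set X),
      IsMaxGroupWitness E H ∧ IsMaxSetWitness G E X' ∧ IsWitnessPair E H X' := by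
  obtain ⟨H, X₀, hH⟩ := h
  let X' : Set X := {x | ∀ g ∈ H, E x (g • x)}
  have h₁ : IsWitnessPair E H X' := hH.of_le hinv le_rfl
    (fun x hx g hg => hH.rel_smul hg hx) fun g hg x hx => hx g hg
  have h₂ : IsWitnessPair E (hinv.classStabilizer X') X' := h₁.of_le hinv
    (fun g hg x hx => hx g hg) subset_rfl fun g hg x hx => hg x hx
  exact ⟨_, X', ⟨X', h₂, fun H' hH' h' => hH'.not_ge fun g hg x hx => h'.rel_smul hg hx⟩,
    ⟨H, h₁, fun X'' hX'' h' => hX''.not_subset fun x hx g hg => h'.rel_smul hg hx⟩, h₂⟩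

end Abstract

namespace MSLanguage

/-! ### Pairs of tuples -/

section Tuples

variable {L : MSLanguage.{u}} {M : L.Srt → Type u} [L.Structure M]
variable {I J K : Type u} {σ : I → L.Srt} {τ : J → L.Srt} {ρ : K → L.Srt} {A : Set (Σ s, M s)}

/-- The first component of a concatenation. -/
def Tuple.fst {S : Type u} {M : S → Type u} {I J : Type u} {σ : I → S} {τ : J → S}
    (z : Tuple M (Sum.elim σ τ)) : Tuple M σ := fun i => z (.inl i)

/-- The second component of a concatenation. -/
def Tuple.snd {S : Type u} {M : S → Type u} {I J : Type u} {σ : I → S} {τ : J → S}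
    (z : Tuple M (Sum.elim σ τ)) : Tuple M τ := fun i => z (.inr i)

theorem Tuple.append_fst_snd {S : Type u} {M : S → Type u} {I J : Type u} {σ : I → S} {τ : J → S}
    (z : Tuple M (Sum.elim σ τ)) : z.fst.append z.snd = z := by
  funext k
  rcases k with k | k <;> rfl

theorem IsSubst.fst {F : Tuple M ρ → Tuple M (Sum.elim σ τ)} (hF : IsSubst A F) :
    IsSubst A fun z => (F z).fst := fun i => hF (.inl i)

theorem IsSubst.snd {F : Tuple M ρ → Tuple M (Sum.elim σ τ)} (hF : IsSubst A F) :
    IsSubst A fun z => (F z).snd := fun i => hF (.inr i)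

theorem IsSubst.append {F : Tuple M ρ → Tuple M σ} {G : Tuple M ρ → Tuple M τ} (hF : IsSubst A F)
    (hG : IsSubst A G) : IsSubst A fun z => (F z).append (G z) := by
  rintro (i | i)
  · exact hF i
  · exact hG i

theorem isSubst_const {c : Tuple M τ} (hc : c.entries ⊆ A) : IsSubst A fun _ : Tuple M σ => c :=
  fun i => exists_term_const (hc (c.mem_entries i))

theorem isSubst_self : IsSubst A fun z : Tuple M σ => z := isSubst_id

theorem sameType_smul (g : Aut L M) (x : Tuple M σ) : SameType x (g • x) := fun φ =>
  (Formula.holds_smul g x φ).symm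

end Tuples

/-! ### Closed subgroups of the Galois group -/

section Galois

variable {L : MSLanguage.{u}} {M : L.Srt → Type u} [L.Structure M]
variable {I J : Type u} {σ : I → L.Srt} {τ : J → L.Srt} {A B : Set (Σ s, M s)} {κ : Cardinal.{u}}

theorem IsMonster.mk_sum_lt (hM : IsMonster L M κ) (hI : #I < κ) (hJ : #J < κ) : #(I ⊕ J) < κ := by
  simpa using add_lt_of_lt hM.aleph0_lt.le hI hJ

theorem IsMonster.exists_smul_append_eq (hM : IsMonster L M κ) (hI : #I < κ) (hJ : #J < κ)
    {x x' : Tuple M σ} {y y' : Tuple M τ} (h : SameType (x.append y) (x'.append y')) :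
    ∃ g : Aut L M, g • x = x' ∧ g • y = y' := by
  obtain ⟨g, hg⟩ := hM.homogeneous _ _ (hM.mk_sum_lt hI hJ) _ _ h
  exact ⟨g, funext fun i => congrFun hg (.inl i), funext fun i => congrFun hg (.inr i)⟩

theorem ClosedOver.typeDefinable (hM : IsMonster L M κ) (hI : #I < κ) (hA : #A < κ)
    {Y : Set (Tuple M σ)} (hY : ClosedOver A Y) : TypeDefinable κ Y :=
  ⟨A, hA, hY.typeDefinableOver hM hI hA⟩

theorem TypeDefinable.exists_closedOver {Y : Set (Tuple M σ)} (hY : TypeDefinable κ Y) :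
    ∃ A : Set (Σ s, M s), #A < κ ∧ ClosedOver A Y :=
  let ⟨A, hA, h⟩ := hY
  ⟨A, hA, h.closedOver⟩

/-- A type-definable set invariant under Lascar strong automorphisms is type-definable over any
small elementary submodel. -/
theorem TypeDefinable.closedOver_of_tarskiVaught (hM : IsMonster L M κ) (hI : #I < κ) (hB : #B < κ)
    (hBT : TarskiVaught B) {Y : Set (Tuple M σ)} (hY : TypeDefinable κ Y)
    (hinv : ∀ g ∈ AutfL L M κ, ∀ y ∈ Y, g • y ∈ Y) : ClosedOver B Y := by
  obtain ⟨A, hA, hY⟩ := hY.exists_closedOver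
  exact hY.of_invariant hM hI hA hB fun g hg => hinv g (hBT.mem_autfL hB hg)

/-- The stabiliser of an enumerated model lies in `AutfL`, hence in `Γ`, so membership of `g` in `Γ`
depends only on `g • e`. -/
theorem mem_of_smul_eq {Γ : Subgroup (Aut L M)} (hΓ : AutfL L M κ ≤ Γ) {e : Tuple M τ}
    (hJ : #J < κ) (he : TarskiVaught e.entries) {g h : Aut L M} (hh : h ∈ Γ) (hg : g • e = h • e) :
    g ∈ Γ := by
  have := Γ.mul_mem hh (hΓ (he.mem_autfL (e.mk_entries_lt hJ) (g := h⁻¹ * g)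
    (fixes_entries (by rw [mul_smul, hg, inv_smul_smul]))))
  simpa using this

/-- As `≡_L`-classes are `AutfL`-orbits and `AutfL ≤ Γ`, the set tested in `GalClosed` is just the
orbit `Γ • e`. -/
theorem setOf_galClosed_eq (hM : IsMonster L M κ) {Γ : Subgroup (Aut L M)}
    {C : Set (Gal L M κ)} (hΓ : AutfL L M κ ≤ Γ)
    (hC : ∀ g : Aut L M, (QuotientGroup.mk g : Gal L M κ) ∈ C ↔ g ∈ Γ) (hJ : #J < κ)
    (e : Tuple M τ) :
    {n : Tuple M τ | SameType e n ∧
      ∃ g : Aut L M, (QuotientGroup.mk g : Gal L M κ) ∈ C ∧ LascarEquiv κ n (g • e)} =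
    {n | ∃ g ∈ Γ, g • e = n} := by
  ext n
  constructor
  · rintro ⟨-, g, hg, hn⟩
    obtain ⟨f, hf, hfn⟩ := (hM.lascarEquiv_iff hJ).1 hn
    exact ⟨f⁻¹ * g, Γ.mul_mem (Γ.inv_mem (hΓ hf)) ((hC g).1 hg), by
      rw [mul_smul, ← hfn, inv_smul_smul]⟩
  · rintro ⟨g, hg, rfl⟩
    exact ⟨sameType_smul g e, g, (hC g).2 hg, fun E _ _ => E.refl _⟩

theorem IsPreimageOfClosed.exists_typeDefinable (hM : IsMonster L M κ) {Γ : Subgroup (Aut L M)}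
    (h : IsPreimageOfClosed κ Γ) : AutfL L M κ ≤ Γ ∧ ∃ (J : Type u) (τ : J → L.Srt)
      (e : Tuple M τ), #J < κ ∧ TarskiVaught e.entries ∧
        TypeDefinable κ {n | ∃ g ∈ Γ, g • e = n} := by
  obtain ⟨K, ⟨N, iN, j, hj, hN, hK⟩, rfl⟩ := h
  have hle : AutfL L M κ ≤ K.comap (QuotientGroup.mk' (AutfL L M κ)) := fun g hg => by
    rw [Subgroup.mem_comap, QuotientGroup.mk'_apply, (QuotientGroup.eq_one_iff g).2 hg]
    exact K.one_mem
  refine ⟨hle, _, _, enumTuple j, hN, hj.tarskiVaught, ?_⟩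
  rwa [← setOf_galClosed_eq hM hle (fun g => Iff.rfl) hN]

theorem isPreimageOfClosed_of_typeDefinable (hM : IsMonster L M κ) {Γ : Subgroup (Aut L M)}
    (hΓ : AutfL L M κ ≤ Γ)
    (h : ∀ (J : Type u) (τ : J → L.Srt) (e : Tuple M τ), #J < κ → TarskiVaught e.entries →
      TypeDefinable κ {n | ∃ g ∈ Γ, g • e = n}) : IsPreimageOfClosed κ Γ := by
  obtain ⟨A, hA, hAT⟩ := hM.exists_tarskiVaught
  obtain ⟨N, iN, j, hj, hN, -⟩ := hAT.exists_isElementary hA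
  have hC : (Γ.map (QuotientGroup.mk' (AutfL L M κ))).comap (QuotientGroup.mk' (AutfL L M κ)) = Γ :=
    Subgroup.comap_map_eq_self (by simpa using hΓ)
  refine ⟨Γ.map (QuotientGroup.mk' (AutfL L M κ)), ⟨N, iN, j, hj, hN, ?_⟩, hC.symm⟩
  rw [setOf_galClosed_eq hM hΓ (fun g => SetLike.ext_iff.1 hC g) hN]
  exact h _ _ _ hN hj.tarskiVaught

/-- The orbit equivalence relation of the preimage of a closed subgroup is type-definable. -/
theorem IsPreimageOfClosed.typeDefinable_orbit (hM : IsMonster L M κ) (hI : #I < κ)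
    {Γ : Subgroup (Aut L M)} (h : IsPreimageOfClosed κ Γ) :
    TypeDefinable κ {z : Tuple M (Sum.elim σ σ) | ∃ g ∈ Γ, g • z.fst = z.snd} := by
  obtain ⟨hΓ, J, τ, e, hJ, he, hcl⟩ := h.exists_typeDefinable hM
  obtain ⟨A, hA, hcl⟩ := hcl.exists_closedOver
  have hA' := hM.mk_union_lt hA (e.mk_entries_lt hJ)
  have hid : IsSubst (A ∪ e.entries) fun z : Tuple M (Sum.elim (Sum.elim σ σ) τ) => z :=
    isSubst_self
  -- The relation is the projection of the set of `(x, y, n)` with `n ∈ Γ • e` and `(e, x) ≡ (n,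
  -- y)`: an automorphism realising this equality of types lies in `Γ` by `mem_of_smul_eq`.
  have hZ := (closedOver_sameType ((isSubst_const Set.subset_union_right).append hid.fst.fst)
    (hid.snd.append hid.fst.snd)).inter ((hcl.mono Set.subset_union_left).preimage hid.snd)
  convert (hZ.image_self hM (hM.mk_sum_lt (hM.mk_sum_lt hI hI) hJ) (hM.mk_sum_lt hI hI) hA'
    hid.fst).typeDefinable hM (hM.mk_sum_lt hI hI) hA' using 1
  ext z
  constructor
  · rintro ⟨g, hg, hz⟩
    refine ⟨z.append (g • e), ⟨?_, g, hg, rfl⟩, rfl⟩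
    have := sameType_smul g (e.append z.fst)
    rw [← append_smul, hz] at this
    exact this
  · rintro ⟨w, ⟨hw, g, hg, hgw⟩, rfl⟩
    obtain ⟨k, hk, hkw⟩ := hM.exists_smul_append_eq hJ hI hw
    exact ⟨k, mem_of_smul_eq hΓ hJ he hg (hk.trans hgw.symm), hkw⟩

end Galois

/-! ### Type-definability of classes, stabilisers and witnesses -/

section Relations

variable {L : MSLanguage.{u}} {M : L.Srt → Type u} [L.Structure M]
variable {I J : Type u} {σ : I → L.Srt} {τ : J → L.Srt} {A B : Set (Σ s, M s)} {κ : Cardinal.{u}}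
variable {X : ZeroTypeDefinable L M κ σ} {E : Setoid X}

theorem ZeroTypeDefinable.smul_mem_iff (X : ZeroTypeDefinable L M κ σ) (g : Aut L M)
    {x : Tuple M σ} : g • x ∈ X.carrier ↔ x ∈ X.carrier :=
  ⟨fun h => by simpa using X.typeDefinable.smul_mem g⁻¹ h, X.typeDefinable.smul_mem g⟩

theorem ZeroTypeDefinable.closedOver (X : ZeroTypeDefinable L M κ σ) (A : Set (Σ s, M s)) :
    ClosedOver A X.carrier := X.typeDefinable.closedOver.mono (Set.empty_subset A)

/-- The graph of a relation on `X`, as a set of tuples. -/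
def relSet (E : Setoid X) : Set (Tuple M (Sum.elim σ σ)) :=
  {z | ∃ x y : X, E x y ∧ z = x.1.append y.1}

theorem mem_relSet {z : Tuple M (Sum.elim σ σ)} {x y : X} (hx : z.fst = x.1) (hy : z.snd = y.1) :
    z ∈ relSet E ↔ E x y := by
  constructor
  · rintro ⟨x', y', h, rfl⟩
    obtain rfl : x' = x := Subtype.ext hx
    obtain rfl : y' = y := Subtype.ext hy
    exact h
  · exact fun h => ⟨x, y, h, by rw [← hx, ← hy, Tuple.append_fst_snd]⟩

theorem rel_smul_of_mem_autfL (hM : IsMonster L M κ) (hI : #I < κ)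
    (hinv : IsInvariantRel (Aut L M) E) (hbdd : #(Quotient E) < κ) {g : Aut L M}
    (hg : g ∈ AutfL L M κ) (x : X) : E x (g • x) :=
  hM.rel_smul hI (ι := Subtype.val) Subtype.val_injective (fun _ _ => rfl) hinv hbdd hg x

/-- A union of classes is `AutfL`-invariant, so its parameters can be moved into any small model
`B`, independently of `Y`. -/
theorem closedOver_image_of_saturated (hM : IsMonster L M κ) (hI : #I < κ)
    (hinv : IsInvariantRel (Aut L M) E) (hbdd : #(Quotient E) < κ) (hB : #B < κ)
    (hBT : TarskiVaught B) {Y : Set X} (hY : TypeDefinableIn Y)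
    (hEY : ∀ x y, E x y → x ∈ Y → y ∈ Y) : ClosedOver B (Subtype.val '' Y) := by
  refine TypeDefinable.closedOver_of_tarskiVaught hM hI hB hBT hY ?_
  rintro g hg _ ⟨x, hx, rfl⟩
  exact ⟨g • x, hEY _ _ (rel_smul_of_mem_autfL hM hI hinv hbdd hg x) hx, rfl⟩

/-- The classes of a type-definable relation are type-definable. -/
theorem TypeDefinableRel.typeDefinableIn_class (hM : IsMonster L M κ) (hI : #I < κ)
    (hE : TypeDefinableRel E) (x : X) : TypeDefinableIn {y : X | E x y} := by
  obtain ⟨A, hA, hcl⟩ := TypeDefinable.exists_closedOver hE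
  have hsub : IsSubst (A ∪ x.1.entries) fun y : Tuple M σ => x.1.append y :=
    (isSubst_const Set.subset_union_right).append isSubst_self
  have hA' := hM.mk_union_lt hA (x.1.mk_entries_lt hI)
  unfold TypeDefinableIn
  convert ((hcl.mono Set.subset_union_left).preimage hsub).typeDefinable hM hI hA' using 1
  ext y
  constructor
  · rintro ⟨y, hy, rfl⟩
    exact ⟨x, y, hy, rfl⟩
  · rintro ⟨x', y', h, hz⟩
    obtain rfl : x = x' := Subtype.ext (congrArg Tuple.fst hz)
    exact ⟨y', h, (congrArg Tuple.snd hz).symm⟩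

/-- The set is the projection of the pairs `(n, y)` with `(e, x) ≡ (n, y)` and `y` in the class of
`x`. Being `AutfL`-invariant, it is closed over `B`, which does not depend on `x`; this permits
intersecting over arbitrarily many `x`. -/
theorem closedOver_orbit_class (hM : IsMonster L M κ) (hI : #I < κ)
    (hinv : IsInvariantRel (Aut L M) E) (hbdd : #(Quotient E) < κ) {x : X}
    (hx : TypeDefinableIn {y : X | E x y}) (hJ : #J < κ) (e : Tuple M τ) (hB : #B < κ)
    (hBT : TarskiVaught B) : ClosedOver B {n | ∃ g : Aut L M, E x (g • x) ∧ g • e = n} := by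
  obtain ⟨A, hA, hcl⟩ := TypeDefinable.exists_closedOver hx
  have hA' := hM.mk_union_lt (hM.mk_union_lt hA (e.mk_entries_lt hJ)) (x.1.mk_entries_lt hI)
  have hid : IsSubst (A ∪ e.entries ∪ x.1.entries) fun z : Tuple M (Sum.elim τ σ) => z :=
    isSubst_self
  have hZ := (closedOver_sameType ((isSubst_const (Set.subset_union_right.trans
    Set.subset_union_left)).append (isSubst_const Set.subset_union_right)) hid).inter
    ((hcl.mono (Set.subset_union_left.trans Set.subset_union_left)).preimage hid.snd)
  refine TypeDefinable.closedOver_of_tarskiVaught (κ := κ) hM hJ hB hBT ?_ ?_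
  · convert (hZ.image_self hM (hM.mk_sum_lt hJ hI) hJ hA' hid.fst).typeDefinable hM hJ hA' using 1
    ext n
    constructor
    · rintro ⟨g, hg, rfl⟩
      refine ⟨(g • e).append (g • x.1), ⟨?_, g • x, hg, rfl⟩, rfl⟩
      exact (append_smul g e x.1).symm ▸ sameType_smul g _
    · rintro ⟨z, ⟨hz, y, hy, hyz⟩, rfl⟩
      have hz : SameType (e.append x.1) (z.fst.append z.snd) := by rwa [Tuple.append_fst_snd]
      obtain ⟨g, hg, hgx⟩ := hM.exists_smul_append_eq hJ hI hz
      obtain rfl : y = g • x := Subtype.ext (hyz.trans hgx.symm)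
      exact ⟨g, hy, hg⟩
  · rintro f hf _ ⟨g, hg, rfl⟩
    refine ⟨f * g, E.trans hg ?_, mul_smul _ _ _⟩
    rw [mul_smul]
    exact rel_smul_of_mem_autfL hM hI hinv hbdd hf _

theorem autfL_le_classStabilizer (hM : IsMonster L M κ) (hI : #I < κ)
    (hinv : IsInvariantRel (Aut L M) E) (hbdd : #(Quotient E) < κ) (X' : Set X) :
    AutfL L M κ ≤ hinv.classStabilizer X' := fun _ hg x _ =>
  rel_smul_of_mem_autfL hM hI hinv hbdd hg x

/-- If the classes are type-definable, then the stabilizer of any family of classes is the preimage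
of a closed subgroup. -/
theorem isPreimageOfClosed_classStabilizer (hM : IsMonster L M κ) (hI : #I < κ)
    (hinv : IsInvariantRel (Aut L M) E) (hbdd : #(Quotient E) < κ)
    (hE : ∀ x : X, TypeDefinableIn {y : X | E x y}) (X' : Set X) :
    IsPreimageOfClosed κ (hinv.classStabilizer X') := by
  refine isPreimageOfClosed_of_typeDefinable hM (autfL_le_classStabilizer hM hI hinv hbdd X') ?_
  intro J τ e hJ he
  have heκ := e.mk_entries_lt hJ
  -- Needed when `X'` is empty: the intersection in `h₂` is then everything.
  have h₁ : ClosedOver e.entries {n : Tuple M τ | SameType e n} :=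
    closedOver_sameType (isSubst_const subset_rfl) isSubst_self
  have h₂ := ClosedOver.sInter (A := e.entries)
    (F := (fun x : X => {n | ∃ g : Aut L M, E x (g • x) ∧ g • e = n}) '' X') (by
      rintro _ ⟨x, -, rfl⟩
      exact closedOver_orbit_class hM hI hinv hbdd (hE x) hJ e heκ he)
  convert (h₁.inter h₂).typeDefinable hM hJ heκ using 1
  ext n
  constructor
  · rintro ⟨g, hg, rfl⟩
    refine ⟨sameType_smul g e, ?_⟩
    rintro _ ⟨x, hx, rfl⟩
    exact ⟨g, hg x hx, rfl⟩
  · rintro ⟨hn, h⟩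
    obtain ⟨g, rfl⟩ := hM.homogeneous _ _ hJ _ _ hn
    refine ⟨g, fun x hx => ?_, rfl⟩
    -- The automorphism `k` depends on `x`, but it agrees with `g` on the model `e`, so the two
    -- differ by an element of `AutfL`.
    obtain ⟨k, hk, hke⟩ := h _ ⟨x, hx, rfl⟩
    have : g⁻¹ * k ∈ AutfL L M κ := he.mem_autfL heκ
      (fixes_entries (by rw [mul_smul, hke, inv_smul_smul]))
    have := (hinv g _ _).1 (rel_smul_of_mem_autfL hM hI hinv hbdd this x)
    rw [mul_smul, smul_inv_smul] at this
    exact E.trans hk (E.symm this)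

/-- The set of points whose class is fixed by an automorphism is type-definable. -/
theorem TypeDefinableRel.typeDefinableIn_fixed (hM : IsMonster L M κ) (hI : #I < κ)
    (hinv : IsInvariantRel (Aut L M) E) (hbdd : #(Quotient E) < κ) (hE : TypeDefinableRel E)
    (h : Aut L M) : TypeDefinableIn {x : X | E x (h • x)} := by
  obtain ⟨A, hA, hcl⟩ := TypeDefinable.exists_closedOver hE
  obtain ⟨B, hB, hBT⟩ := hM.exists_tarskiVaught
  let e : Tuple M (fun a : B => a.1.1) := params B
  have he : e.entries = B := by
    ext a
    exact ⟨by rintro ⟨b, rfl⟩; exact b.2, fun ha => ⟨⟨a, ha⟩, rfl⟩⟩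
  let C := A ∪ e.entries ∪ (h • e).entries
  have hC : #C < κ := hM.mk_union_lt (hM.mk_union_lt hA (e.mk_entries_lt hB))
    ((h • e).mk_entries_lt hB)
  have hid : IsSubst C fun z : Tuple M (Sum.elim σ σ) => z := isSubst_self
  -- Projection of the pairs `(x, y)` with `E x y` and `(e, x) ≡ (h • e, y)`. The second condition
  -- says `y = g • x` for some `g` agreeing with `h` on a model, so `y` is equivalent to `h • x`.
  have hZ := (closedOver_sameType
    ((isSubst_const (Set.subset_union_right.trans Set.subset_union_left)).append hid.fst)
    ((isSubst_const Set.subset_union_right).append hid.snd)).inter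
    (hcl.mono (B := C) (Set.subset_union_left.trans Set.subset_union_left))
  unfold TypeDefinableIn
  convert (hZ.image_self hM (hM.mk_sum_lt hI hI) hI hC hid.fst).typeDefinable hM hI hC using 1
  ext x
  constructor
  · rintro ⟨x, hx, rfl⟩
    refine ⟨x.1.append (h • x.1), ⟨?_, x, h • x, hx, rfl⟩, rfl⟩
    have := sameType_smul h (e.append x.1)
    rw [← append_smul] at this
    exact this
  · rintro ⟨_, ⟨hz, x, y, hxy, rfl⟩, rfl⟩
    refine ⟨x, ?_, rfl⟩
    obtain ⟨g, hge, hgx⟩ := hM.exists_smul_append_eq hB hI hz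
    have hg : h⁻¹ * g ∈ AutfL L M κ := hBT.mem_autfL hB
      (he ▸ fixes_entries (by rw [mul_smul, hge, inv_smul_smul]))
    have := (hinv h _ _).1 (rel_smul_of_mem_autfL hM hI hinv hbdd hg x)
    rw [mul_smul, smul_inv_smul, show g • x = y from Subtype.ext hgx] at this
    exact E.trans hxy (E.symm this)

/-- Maximal sets witnessing weak orbitality of a type-definable relation are type-definable. -/
theorem TypeDefinableRel.typeDefinableIn_of_isMaxSetWitness (hM : IsMonster L M κ) (hI : #I < κ)
    (hinv : IsInvariantRel (Aut L M) E) (hbdd : #(Quotient E) < κ) (hE : TypeDefinableRel E)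
    {X' : Set X} (hX' : IsMaxSetWitness (Aut L M) E X') : TypeDefinableIn X' := by
  obtain ⟨H, rfl⟩ := hX'.eq_fixed hinv
  obtain ⟨B, hB, hBT⟩ := hM.exists_tarskiVaught
  -- Each of these sets is a union of classes, so a single `B` serves for all `h`, and `H` need not
  -- be small.
  have hcl : ∀ h : Aut L M, ClosedOver B (Subtype.val '' {x : X | E x (h • x)}) := fun h =>
    closedOver_image_of_saturated hM hI hinv hbdd hB hBT
      (hE.typeDefinableIn_fixed hM hI hinv hbdd h) fun x y hxy hx =>
        E.trans (E.symm hxy) (E.trans hx ((hinv h _ _).1 hxy))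
  unfold TypeDefinableIn
  convert (ClosedOver.sInter (F := (fun h : Aut L M => Subtype.val '' {x : X | E x (h • x)}) '' H)
    (by rintro _ ⟨h, -, rfl⟩; exact hcl h)).typeDefinable hM hI hB using 1
  ext x
  constructor
  · rintro ⟨x, hx, rfl⟩ _ ⟨h, hh, rfl⟩
    exact ⟨x, hx h hh, rfl⟩
  · intro hx
    obtain ⟨x, -, rfl⟩ := hx _ ⟨1, H.one_mem, rfl⟩
    refine ⟨x, fun h hh => ?_, rfl⟩
    obtain ⟨y, hy, hyx⟩ := hx _ ⟨h, hh, rfl⟩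
    rwa [Subtype.ext hyx] at hy

/-- `R_{Γ, X'}` is type-definable if `X'` is and `Γ` is the preimage of a closed subgroup. -/
theorem IsPreimageOfClosed.typeDefinableRel (hM : IsMonster L M κ) (hI : #I < κ)
    {Γ : Subgroup (Aut L M)} (hΓ : IsPreimageOfClosed κ Γ) {X' : Set X} (hX' : TypeDefinableIn X')
    (hE : IsWitnessPair E Γ X') : TypeDefinableRel E := by
  obtain ⟨A, hA, hclA⟩ := TypeDefinable.exists_closedOver hX'
  obtain ⟨B, hB, hclB⟩ := (hΓ.typeDefinable_orbit (σ := σ) hM hI).exists_closedOver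
  have hII := hM.mk_sum_lt hI hI
  have hAB := hM.mk_union_lt hA hB
  have hid : IsSubst (A ∪ B) fun z : Tuple M (Sum.elim (Sum.elim σ σ) (Sum.elim σ σ)) => z :=
    isSubst_self
  -- Quadruples `(x₁, x₂, y₁, y₂)` such that `(x₁, x₂) ≡ (y₁, y₂)`, `y₁ ∈ X'`, and `Γ` moves `y₁` to
  -- `y₂`; the relation is their projection to `(x₁, x₂)`.
  have hZ := ((closedOver_sameType hid.fst hid.snd).inter
    ((hclA.mono Set.subset_union_left).preimage hid.snd.fst)).inter
    ((hclB.mono Set.subset_union_right).preimage hid.snd)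
  unfold TypeDefinableRel
  convert (hZ.image_self hM (hM.mk_sum_lt hII hII) hII hAB hid.fst).typeDefinable hM hII hAB using 1
  ext z
  constructor
  · rintro ⟨x, y, hxy, rfl⟩
    obtain ⟨g, h, hh, h₁, h₂⟩ := (hE x y).1 hxy
    refine ⟨(x.1.append y.1).append (g • x.1.append y.1), ⟨⟨sameType_smul g _, g • x, h₂, rfl⟩,
      h⁻¹, Γ.inv_mem hh, ?_⟩, rfl⟩
    exact congrArg Subtype.val (inv_smul_eq_iff.2 h₁)
  · rintro ⟨w, ⟨⟨hw, y, hy, hyw⟩, h, hh, hhw⟩, rfl⟩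
    obtain ⟨g, hg⟩ := hM.homogeneous _ _ hII _ _ hw
    have hg₁ : g • w.fst.fst = y.1 := (congrArg Tuple.fst hg).trans hyw.symm
    have hg₂ : g • w.fst.snd = h • y.1 := by
      rw [hyw]
      exact (congrArg Tuple.snd hg).trans hhw.symm
    have hx₁ : w.fst.fst ∈ X.carrier := (X.smul_mem_iff g).1 (hg₁ ▸ y.2)
    have hx₂ : w.fst.snd ∈ X.carrier := (X.smul_mem_iff g).1 (hg₂ ▸ (X.smul_mem_iff h).2 y.2)
    have hy₁ : g • (⟨_, hx₁⟩ : X) = y := Subtype.ext hg₁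
    have hy₂ : g • (⟨_, hx₂⟩ : X) = h • y := Subtype.ext hg₂
    refine ⟨⟨_, hx₁⟩, ⟨_, hx₂⟩, (hE _ _).2 ⟨g, h⁻¹, Γ.inv_mem hh, ?_, ?_⟩,
      (Tuple.append_fst_snd _).symm⟩
    · rw [hy₁, hy₂, inv_smul_smul]
    · rwa [hy₁]

end Relations

/-! ### The logic topology and the Hausdorff property -/

section LogicTopology

variable {L : MSLanguage.{u}} {M : L.Srt → Type u} [L.Structure M]
variable {I : Type u} {σ : I → L.Srt} {A B : Set (Σ s, M s)} {κ : Cardinal.{u}}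
variable {X : ZeroTypeDefinable L M κ σ} {E : Setoid X}

theorem typeDefinableIn_preimage_iff (hM : IsMonster L M κ) (hI : #I < κ)
    (hinv : IsInvariantRel (Aut L M) E) (hbdd : #(Quotient E) < κ) (hB : #B < κ)
    (hBT : TarskiVaught B) {C : Set (Quotient E)} :
    TypeDefinableIn (Quotient.mk E ⁻¹' C) ↔
      ClosedOver B (Subtype.val '' (Quotient.mk E ⁻¹' C)) :=
  ⟨fun h => closedOver_image_of_saturated hM hI hinv hbdd hB hBT h fun x y hxy hx => by
    rwa [Set.mem_preimage, ← Quotient.sound hxy], fun h => h.typeDefinable hM hI hB⟩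

/-- The logic topology exists. -/
theorem exists_isLogicTopology (hM : IsMonster L M κ) (hI : #I < κ)
    (hinv : IsInvariantRel (Aut L M) E) (hbdd : #(Quotient E) < κ) :
    ∃ t : TopologicalSpace (Quotient E), IsLogicTopology E t := by
  obtain ⟨B, hB, hBT⟩ := hM.exists_tarskiVaught
  -- Closedness is tested over one fixed model `B`, which makes stability under arbitrary
  -- intersections clear.
  refine ⟨TopologicalSpace.ofClosed
    {C | ClosedOver B (Subtype.val '' (Quotient.mk E ⁻¹' C))} ?_ ?_ ?_, fun C => ?_⟩
  · simpa using definableOver_empty.closedOver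
  · intro S hS
    change ClosedOver B (Subtype.val '' (Quotient.mk E ⁻¹' ⋂₀ S))
    -- The factor `X` accounts for the empty intersection.
    convert (X.closedOver B).inter (ClosedOver.sInter (A := B)
      (F := (fun C => Subtype.val '' (Quotient.mk E ⁻¹' C)) '' S)
      (by rintro _ ⟨C, hC, rfl⟩; exact hS hC)) using 1
    ext x
    constructor
    · rintro ⟨x, hx, rfl⟩
      refine ⟨x.2, ?_⟩
      rintro _ ⟨C, hC, rfl⟩
      exact ⟨x, hx C hC, rfl⟩
    · rintro ⟨hx, h⟩
      refine ⟨⟨x, hx⟩, fun C hC => ?_, rfl⟩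
      obtain ⟨y, hy, hyx⟩ := h _ ⟨C, hC, rfl⟩
      rwa [show (⟨x, hx⟩ : X) = y from Subtype.ext hyx.symm]
  · intro C hC D hD
    rw [Set.mem_ofPred_eq, Set.preimage_union, Set.image_union]
    exact hC.union hD
  · rw [typeDefinableIn_preimage_iff hM hI hinv hbdd hB hBT]
    refine (@isOpen_compl_iff _ C (_)).symm.trans ?_
    change ClosedOver B _ ↔ _
    rw [compl_compl]

/-- By compactness, if `Z` met every definable set containing `Y`, it would meet their intersection,
which is `Y`. -/
theorem ClosedOver.exists_definableOver_separating (hM : IsMonster L M κ) (hI : #I < κ)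
    (hA : #A < κ) {Y Z : Set (Tuple M σ)} (hY : ClosedOver A Y) (hZ : ClosedOver A Z)
    (h : Disjoint Y Z) : ∃ D, DefinableOver A D ∧ Y ⊆ D ∧ Disjoint Z D := by
  by_contra! hne
  obtain ⟨x, hx⟩ := hM.nonempty_sInter_closedOver hI hA
    (F := insert Z {D | DefinableOver A D ∧ Y ⊆ D})
    (by
      rintro _ (rfl | hD)
      · exact hZ
      · exact hD.1.closedOver) (by
      intro t ht htf
      have ht' : ∀ D ∈ t \ {Z}, DefinableOver A D ∧ Y ⊆ D := fun D hD => (ht hD.1).resolve_left hD.2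
      obtain ⟨x, hxZ, hx⟩ := Set.not_disjoint_iff.1 (hne (⋂₀ (t \ {Z}))
        (DefinableOver.sInter htf.sdiff fun D hD => (ht' D hD).1)
        (Set.subset_sInter fun D hD => (ht' D hD).2))
      refine ⟨x, fun D hD => ?_⟩
      by_cases hDZ : D = Z
      · rwa [hDZ]
      · exact hx D ⟨hD, hDZ⟩)
  refine Set.disjoint_left.1 h (by_contra fun hxY => ?_) (hx Z (.inl rfl))
  obtain ⟨D, hD, hYD, hxD⟩ := hY x hxY
  exact hxD (hx D (.inr ⟨hD, hYD⟩))

theorem TypeDefinableRel.typeDefinableIn_saturation (hM : IsMonster L M κ) (hI : #I < κ)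
    (hE : TypeDefinableRel E) (hA : #A < κ) {D : Set (Tuple M σ)} (hD : DefinableOver A D) :
    TypeDefinableIn {x : X | ∃ y, E x y ∧ y.1 ∈ D} := by
  obtain ⟨B, hB, hcl⟩ := TypeDefinable.exists_closedOver hE
  have hAB := hM.mk_union_lt hA hB
  have hid : IsSubst (A ∪ B) fun z : Tuple M (Sum.elim σ σ) => z := isSubst_self
  have hZ := (hcl.mono (B := A ∪ B) Set.subset_union_right).inter
    ((hD.mono Set.subset_union_left).closedOver.preimage hid.snd)
  unfold TypeDefinableIn
  convert (hZ.image_self hM (hM.mk_sum_lt hI hI) hI hAB hid.fst).typeDefinable hM hI hAB using 1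
  ext x
  constructor
  · rintro ⟨x, ⟨y, hxy, hy⟩, rfl⟩
    exact ⟨_, ⟨⟨x, y, hxy, rfl⟩, hy⟩, rfl⟩
  · rintro ⟨_, ⟨⟨x, y, hxy, rfl⟩, hy⟩, rfl⟩
    exact ⟨x, ⟨y, hxy, hy⟩, rfl⟩

/-- Two distinct classes are separated by a definable `D`. The classes meeting `D` form a closed
set, and so do those meeting `Dᶜ`; the complements are disjoint because every class meets one of the
two. -/
theorem TypeDefinableRel.t2Space (hM : IsMonster L M κ) (hI : #I < κ) (hE : TypeDefinableRel E)
    {t : TopologicalSpace (Quotient E)} (ht : IsLogicTopology E t) : T2Space (Quotient E) := by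
  refine ⟨fun p q hpq => ?_⟩
  induction p using Quotient.inductionOn with | _ x
  induction q using Quotient.inductionOn with | _ y
  obtain ⟨A, hA, hclA⟩ := TypeDefinable.exists_closedOver (hE.typeDefinableIn_class hM hI x)
  obtain ⟨B, hB, hclB⟩ := TypeDefinable.exists_closedOver (hE.typeDefinableIn_class hM hI y)
  have hAB := hM.mk_union_lt hA hB
  obtain ⟨D, hD, hxD, hyD⟩ := (hclA.mono
    Set.subset_union_left).exists_definableOver_separating hM hI hAB
    (hclB.mono Set.subset_union_right) (Set.disjoint_left.2 (by
      rintro _ ⟨w, hw, rfl⟩ ⟨w', hw', h⟩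
      obtain rfl : w' = w := Subtype.ext h
      exact hpq (Quotient.sound (E.trans hw (E.symm hw')))))
  have hclosed : ∀ D : Set (Tuple M σ), DefinableOver (A ∪ B) D →
      IsClosed {q : Quotient E | ∃ w : X, Quotient.mk E w = q ∧ w.1 ∈ D} := by
    intro D hD
    rw [ht]
    convert hE.typeDefinableIn_saturation hM hI hAB hD using 1
    ext w
    exact exists_congr fun w' => and_congr_left' ⟨fun h => E.symm (Quotient.exact h),
      fun h => Quotient.sound (E.symm h)⟩
  refine ⟨_, _, (hclosed _ hD.compl).isOpen_compl, (hclosed _ hD).isOpen_compl, ?_, ?_, ?_⟩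
  · rintro ⟨w, hw, hwD⟩
    exact hwD (hxD ⟨w, E.symm (Quotient.exact hw), rfl⟩)
  · rintro ⟨w, hw, hwD⟩
    exact Set.disjoint_left.1 hyD ⟨w, E.symm (Quotient.exact hw), rfl⟩ hwD
  · refine Set.disjoint_left.2 fun q => ?_
    induction q using Quotient.inductionOn with | _ w
    intro h₁ h₂
    by_cases hw : w.1 ∈ D
    · exact h₂ ⟨w, rfl, hw⟩
    · exact h₁ ⟨w, rfl, hw⟩

/-- If disjoint open `U`, `V` separate the classes of an inequivalent pair, then "`x ∉ U` or `y ∉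
V`" is a closed condition over `B` that contains `E` and excludes the pair. -/
theorem typeDefinableRel_of_t2Space (hM : IsMonster L M κ) (hI : #I < κ)
    (hinv : IsInvariantRel (Aut L M) E) (hbdd : #(Quotient E) < κ)
    {t : TopologicalSpace (Quotient E)} (ht : IsLogicTopology E t) [T2Space (Quotient E)] :
    TypeDefinableRel E := by
  obtain ⟨B, hB, hBT⟩ := hM.exists_tarskiVaught
  have hid : IsSubst B fun z : Tuple M (Sum.elim σ σ) => z := isSubst_self
  have hX : relSet E ⊆ {z | z.fst ∈ X.carrier ∧ z.snd ∈ X.carrier} := by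
    rintro _ ⟨x, y, -, rfl⟩
    exact ⟨x.2, y.2⟩
  suffices ClosedOver B (relSet E) from this.typeDefinable hM (hM.mk_sum_lt hI hI) hB
  intro z hz
  by_cases hzX : z.fst ∈ X.carrier ∧ z.snd ∈ X.carrier
  · have hxy : Quotient.mk E ⟨_, hzX.1⟩ ≠ Quotient.mk E ⟨_, hzX.2⟩ := fun h =>
      hz ((mem_relSet (x := ⟨_, hzX.1⟩) (y := ⟨_, hzX.2⟩) rfl rfl).2 (Quotient.exact h))
    obtain ⟨U, V, hU, hV, hxU, hyV, hUV⟩ := t2_separation hxy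
    have hcl : ∀ C : Set (Quotient E), IsOpen C →
        ClosedOver B (Subtype.val '' (Quotient.mk E ⁻¹' Cᶜ)) := fun C hC =>
      (typeDefinableIn_preimage_iff hM hI hinv hbdd hB hBT).1 ((ht _).1 hC.isClosed_compl)
    have hW := ((hcl U hU).preimage hid.fst).union ((hcl V hV).preimage hid.snd)
    obtain ⟨D, hD, hWD, hzD⟩ := hW z (by
      rintro (⟨w, hw, hwz⟩ | ⟨w, hw, hwz⟩)
      · obtain rfl : w = ⟨_, hzX.1⟩ := Subtype.ext hwz
        exact hw hxU
      · obtain rfl : w = ⟨_, hzX.2⟩ := Subtype.ext hwz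
        exact hw hyV)
    refine ⟨D, hD, fun w hw => hWD ?_, hzD⟩
    obtain ⟨x, y, hxy, rfl⟩ := hw
    by_cases hx : Quotient.mk E x ∈ U
    · exact .inr ⟨y, fun hy => Set.disjoint_left.1 hUV hx ((Quotient.sound hxy : _ = _) ▸ hy), rfl⟩
    · exact .inl ⟨x, hx, rfl⟩
  · obtain ⟨D, hD, hXD, hzD⟩ := (((X.closedOver B).preimage hid.fst).inter
      ((X.closedOver B).preimage hid.snd)) z hzX
    exact ⟨D, hD, hX.trans hXD, hzD⟩

end LogicTopology

end MSLanguage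

/-! ### The equivalences -/

theorem mainTheorem10 (L : MSLanguage.{u}) (M : L.Srt → Type u) [L.Structure M]
    (κ : Cardinal.{u}) (hM : MSLanguage.IsMonster L M κ)
    (I : Type u) (hI : #I < κ) (σ : I → L.Srt)
    (X : MSLanguage.ZeroTypeDefinable L M κ σ) (E : Setoid X)
    (hinv : IsInvariantRel (MSLanguage.Aut L M) E)
    (hbdd : #(Quotient E) < κ)
    (hworb : IsWeaklyOrbital (MSLanguage.Aut L M) E) :
    List.TFAE [
      -- `E` is type-definable
      MSLanguage.TypeDefinableRel E,
      -- the classes are type-definable, and `E` is weakly orbital by type-definable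
      (∀ x : X, MSLanguage.TypeDefinableIn {y : X | E x y}) ∧
        ∃ (Γ : Subgroup (MSLanguage.Aut L M)) (X' : Set X),
          MSLanguage.TypeDefinableIn X' ∧ IsWitnessPair E Γ X',
      -- `E = R_{Γ, X'}` with `X'` type-definable and `Γ` the preimage of a closed subgroup
      ∃ (Γ : Subgroup (MSLanguage.Aut L M)) (X' : Set X),
        MSLanguage.TypeDefinableIn X' ∧ MSLanguage.IsPreimageOfClosed κ Γ ∧ IsWitnessPair E Γ X',
      -- maximal witnesses are preimages of closed subgroups, respectively type-definable
      (∀ Γ : Subgroup (MSLanguage.Aut L M), IsMaxGroupWitness E Γ →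
          MSLanguage.IsPreimageOfClosed κ Γ) ∧
        ∀ X' : Set X, IsMaxSetWitness (MSLanguage.Aut L M) E X' → MSLanguage.TypeDefinableIn X',
      -- `X / E` is Hausdorff in the logic topology
      ∃ t : TopologicalSpace (Quotient E), MSLanguage.IsLogicTopology E t ∧ @T2Space _ t] := by
  have hgroup : (∀ x : X, MSLanguage.TypeDefinableIn {y : X | E x y}) →
      ∀ Γ : Subgroup (MSLanguage.Aut L M), IsMaxGroupWitness E Γ →
        MSLanguage.IsPreimageOfClosed κ Γ := by
    intro hE Γ hΓ
    obtain ⟨X', rfl⟩ := hΓ.eq_classStabilizer hinv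
    exact MSLanguage.isPreimageOfClosed_classStabilizer hM hI hinv hbdd hE X'
  have hset := fun hE : MSLanguage.TypeDefinableRel E => fun X' =>
    hE.typeDefinableIn_of_isMaxSetWitness hM hI hinv hbdd (X' := X')
  tfae_have 1 → 5 := fun hE =>
    let ⟨t, ht⟩ := MSLanguage.exists_isLogicTopology hM hI hinv hbdd
    ⟨t, ht, hE.t2Space hM hI ht⟩
  tfae_have 5 → 1 := fun ⟨_, ht, _⟩ =>
    MSLanguage.typeDefinableRel_of_t2Space hM hI hinv hbdd ht
  tfae_have 1 → 4 := fun hE => ⟨hgroup (hE.typeDefinableIn_class hM hI), hset hE⟩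
  tfae_have 4 → 3 := fun ⟨h₁, h₂⟩ =>
    let ⟨Γ, X', hΓ, hX', h⟩ := hworb.exists_max hinv
    ⟨Γ, X', h₂ X' hX', h₁ Γ hΓ, h⟩
  tfae_have 3 → 1 := fun ⟨_, _, hX', hΓ, h⟩ => hΓ.typeDefinableRel hM hI hX' h
  tfae_have 1 → 2 := fun hE =>
    let ⟨Γ, X', _, hX', h⟩ := hworb.exists_max hinv
    ⟨hE.typeDefinableIn_class hM hI, Γ, X', hset hE X' hX', h⟩
  -- The set `X'` is kept and the group is replaced by the full stabiliser of the classes meeting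
  -- `X'`.
  tfae_have 2 → 3 := fun ⟨hE, _, X', hX', h⟩ =>
    ⟨hinv.classStabilizer X', X', hX',
      MSLanguage.isPreimageOfClosed_classStabilizer hM hI hinv hbdd hE X',
      h.of_le hinv (fun _ hg _ hx => h.rel_smul hg hx) subset_rfl fun _ hg x hx => hg x hx⟩
  tfae_finish
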